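/- **Setting.** Let a process have input variables $I$ and output variables $O$, $I\cap O=\emptyset$, and let $V=I\cup O$. Let $O'=\{o' : o\in O\}$ be a set of fresh primed copies of the outputs and $V'=I\cup O'$; $\mathit{pr}$ replaces every $o\in O$ by $o'$ and $\mathit{unpr}$ replaces every $o'$ by $o$ (inputs are unchanged). A strategy is a function $s:(2^I)^*\to 2^O$; its computation on $\gamma\in(2^I)^\omega$ is the word $\mathrm{comp}(s,\gamma)\in(2^V)^\omega$ with $\mathrm{comp}(s,\gamma)_n=\gamma_n\cup s(\gamma_0\cdots\gamma_{n-1})$. An alternating co-Büchi automaton (ACA) $(Q,q_0,\delta,F)$ over $2^{\Sigma}$ has a finite state set $Q$, an initial state $q_0$, a transition function $\delta$ mapping $Q\times 2^{\Sigma}$ to positive Boolean formulas over $Q$ in disjunctive normal form, written as sets of clauses (a clause is a subset of $Q$), and a set $F\subseteq Q$ of rejecting states. A run tree on $\sigma$ is a $Q$-labeled tree $(T,\ell)$, $T\subseteq\mathbb N^*$ prefix-closed, with $\ell(\varepsilon)=q_0$ such that for every node $x\in T$ the set of labels of its children is a clause of $\delta(\ell(x),\sigma_{|x|})$; $\sigma$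 is accepted if some run tree visits rejecting states only finitely often on each infinite branch. $\mathcal L(\cdot)$ denotes the set of accepted words, respectively of the words satisfying an LTL formula. For an ACA $\mathcal A=(Q,q_0,\delta,F)$ over $2^V$ and $\sigma,\sigma'\in(2^V)^\omega$, the delay-dominance game $(\mathcal A,\sigma,\sigma')$ is played by Spoiler and Duplicator from the pair $(q_0,q_0)$ in rounds $j=0,1,\dots$: at the pair $(p,q)$, Spoiler chooses $c\in\delta(p,\sigma_j)$, then Duplicator $c'\in\delta(q,\sigma'_j)$, then Spoiler $q'\in c'$, then Duplicator $p'\in c$, and the next pair is $(p',q')$. Duplicator wins a play if whenever $q\in F$ in some round, then $p\in F$ in that or a later round. A strategy $s$ *delay-dominates* $t$ for $\mathcal A$ on $\gamma$ if Duplicator has a winning strategy in $(\mathcal A,\mathrm{comp}(t,\gamma),\mathrm{comp}(s,\gamma))$. **Lemma.** Let $\varphi$ be an LTL formula over $V$. Let $\mathcal A_\varphi=(Q,q_0,\delta,F)$ and $\mathcal A_{\neg\varphi}=(Q^c,q_0^c,\delta^c,F^c)$ be ACAs over $2^V$ with $\mathcal L(\mathcal A_\varphi)=\mathcal L(\varphi)$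 and $\mathcal L(\mathcal A_{\neg\varphi})=\mathcal L(\neg\varphi)$, where the formulas $\delta(q,a)$ contain no constants: each $\delta(q,a)$ has at least one clause and each of its clauses is nonempty. Let $\mathcal B$ be the ACA over $2^{V\cup O'}$ with states $(Q\times Q\times\{\top,\bot\})\uplus Q^c$, initial state $(q_0,q_0,\top)$, rejecting states $(Q\times Q\times\{\bot\})\cup F^c$ and the following transition function, where $\iota=\tilde\iota\cap V$ and $\iota'=\mathit{unpr}(\tilde\iota\cap V')$ for $\tilde\iota\subseteq V\cup O'$, and the formulas are brought into disjunctive normal form by distributivity: $$\tilde\delta(r,\tilde\iota)=\delta^c(r,\iota')\quad (r\in Q^c),\qquad \tilde\delta((q_0,q_0,\top),\tilde\iota)=\delta^c(q_0^c,\iota')\lor\Phi(q_0,q_0,\top),$$ $$\tilde\delta((p,q,m),\tilde\iota)=\Phi(p,q,m)\ \text{ for all other }(p,q,m),\qquad \Phi(p,q,m)=\bigwedge_{c\in\delta(p,\iota')}\ \bigvee_{c'\in\delta(q,\iota)}\ \bigwedge_{q'\in c'}\ \bigvee_{p'\in c}\vartheta(p',q',m),$$ where $\vartheta(p,q,m)=(p,q,\bot)$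 if $p\notin F$ and ($q\in F$ or $m=\bot$), and $\vartheta(p,q,m)=(p,q,\top)$ otherwise. Then, for all strategies $s,t$ and every $\gamma\in(2^I)^\omega$, $\mathcal B$ accepts the word $\mathrm{comp}(s,\gamma)\cup\mathit{pr}(\mathrm{comp}(t,\gamma)\cap O)$ if and only if $s$ delay-dominates $t$ for $\mathcal A_\varphi$ on $\gamma$. -/

import Mathlib

namespace DelayDom

universe u v w x

/-! ### Infinite words and LTL -/

/-- Infinite words over the alphabet `2^AP`. -/
abbrev Word (AP : Type u) : Type u := ℕ → Set AP

/-- The suffix of a word that starts at position `n`. -/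
def Word.drop {AP : Type u} (σ : Word AP) (n : ℕ) : Word AP := fun k => σ (n + k)

/-- Syntax of LTL over the atomic propositions `AP`. -/
inductive LTL (AP : Type u) : Type u
  | atom (a : AP) : LTL AP
  | neg (φ : LTL AP) : LTL AP
  | or (φ ψ : LTL AP) : LTL AP
  | and (φ ψ : LTL AP) : LTL AP
  | next (φ : LTL AP) : LTL AP
  | until (φ ψ : LTL AP) : LTL AP

/-- Standard semantics of LTL. -/
def LTL.Sat {AP : Type u} : LTL AP → Word AP → Prop
  | .atom a, σ => a ∈ σ 0
  | .neg φ, σ => ¬ φ.Sat σ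
  | .or φ ψ, σ => φ.Sat σ ∨ ψ.Sat σ
  | .and φ ψ, σ => φ.Sat σ ∧ ψ.Sat σ
  | .next φ, σ => φ.Sat (σ.drop 1)
  | .until φ ψ, σ => ∃ n, ψ.Sat (σ.drop n) ∧ ∀ k < n, φ.Sat (σ.drop k)

/-- The language of an LTL formula. -/
def LTL.language {AP : Type u} (φ : LTL AP) : Set (Word AP) := {σ | φ.Sat σ}

/-! ### Positive Boolean formulas in disjunctive normal form -/

/-- Positive Boolean formulas over `Q` in DNF, in set notation: `⋁ᵢ ⋀ⱼ cᵢⱼ` is the set of the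
clauses `{cᵢⱼ | j}`. -/
abbrev DNF (Q : Type u) : Type u := Set (Set Q)

namespace DNF

/-- The formula that consists of the single atom `q`. -/
def atom {Q : Type u} (q : Q) : DNF Q := {{q}}

/-- Disjunction of two formulas. -/
def or {Q : Type u} (D E : DNF Q) : DNF Q := D ∪ E

/-- The disjunction `⋁_{i ∈ I} D i`. -/
def bigOr {Q : Type u} {ι : Type v} (I : Set ι) (D : ι → DNF Q) : DNF Q := ⋃ i ∈ I, D i

/-- The conjunction `⋀_{i ∈ I} D i`, brought into DNF by distributivity: a clause of it is the
union of one clause of each `D i`. -/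
def bigAnd {Q : Type u} {ι : Type v} (I : Set ι) (D : ι → DNF Q) : DNF Q :=
  {X | ∃ f : ι → Set Q, (∀ i ∈ I, f i ∈ D i) ∧ X = ⋃ i ∈ I, f i}

/-- Renaming of the atoms. -/
def map {Q : Type u} {R : Type v} (g : Q → R) (D : DNF Q) : DNF R := (fun c => g '' c) '' D

end DNF

/-! ### Alternating co-Büchi automata -/

/-- Alternating co-Büchi automata with finite state set `Q` over the alphabet `2^AP`;
`rej` is the set of rejecting states. -/
structure ACA (AP : Type u) (Q : Type v) [Finite Q] where
  init : Q
  trans : Q → Set AP → DNF Q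
  rej : Set Q

namespace ACA

variable {AP : Type u} {Q : Type v} [Finite Q]

/-- No value of the transition function is the constant `false` (the empty disjunction) or has
the constant `true` (the empty conjunction) as a clause. -/
def NoConstants (A : ACA AP Q) : Prop :=
  ∀ q a, (A.trans q a).Nonempty ∧ ∀ c ∈ A.trans q a, c.Nonempty

/-- `(T, ℓ)` is a run tree of `A` induced by `σ`. Nodes are finite sequences of naturals, the
children of `x` in `T` are the nodes `x ++ [d] ∈ T`; only the labels of nodes in `T` matter. -/
structure IsRunTree (A : ACA AP Q) (σ : Word AP) (T : Set (List ℕ)) (ℓ : List ℕ → Q) : Prop where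
  root_mem : [] ∈ T
  prefix_closed : ∀ x y, x <+: y → y ∈ T → x ∈ T
  root_label : ℓ [] = A.init
  children : ∀ x ∈ T, {q | ∃ d : ℕ, x ++ [d] ∈ T ∧ ℓ (x ++ [d]) = q} ∈ A.trans (ℓ x) (σ x.length)

/-- `b` is an infinite branch of the tree `T`. -/
def IsInfBranch (T : Set (List ℕ)) (b : ℕ → List ℕ) : Prop :=
  b 0 = [] ∧ ∀ n, b n ∈ T ∧ ∃ d : ℕ, b (n + 1) = b n ++ [d]

/-- `A` accepts `σ`: some run tree visits on every infinite branch rejecting states only finitely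
often. -/
def Accepts (A : ACA AP Q) (σ : Word AP) : Prop :=
  ∃ T ℓ, A.IsRunTree σ T ℓ ∧ ∀ b, IsInfBranch T b → {n | ℓ (b n) ∈ A.rej}.Finite

/-- The language of `A`. -/
def language (A : ACA AP Q) : Set (Word AP) := {σ | A.Accepts σ}

end ACA

/-! ### Two-player games -/

/-- Games with positions `V`. Player 0 owns the positions in `own₀`, Player 1 all others;
`win` is the set of sequences that are winning for Player 0. -/
structure Game (V : Type u) where
  own₀ : Set V
  init : V
  edge : V → V → Prop
  win : Set (ℕ → V)

namespace Game

variable {V : Type u} (G : Game V)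

/-- Infinite plays. -/
def IsPlay (ρ : ℕ → V) : Prop := ∀ j, G.edge (ρ j) (ρ (j + 1))

/-- `τ` is a strategy for Player 0: it maps a nonempty history that ends in a position `v` of
Player 0 to a successor of `v`. (At a position without successors its value is irrelevant.) -/
def IsStrategy₀ (τ : List V → V) : Prop :=
  ∀ (h : List V) (v : V), v ∈ G.own₀ → (∃ v', G.edge v v') → G.edge v (τ (h ++ [v]))

/-- The play `ρ` is consistent with the strategy `τ` of Player 0. -/
def Consistent₀ (τ : List V → V) (ρ : ℕ → V) : Prop :=
  ∀ j, ρ j ∈ G.own₀ → ρ (j + 1) = τ ((List.range (j + 1)).map ρ)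

/-- `τ` is a winning strategy for Player 0. -/
def IsWinning₀ (τ : List V → V) : Prop :=
  G.IsStrategy₀ τ ∧ ∀ ρ, G.IsPlay ρ → ρ 0 = G.init → G.Consistent₀ τ ρ → ρ ∈ G.win

/-- Player 0 wins the game. -/
def Wins₀ : Prop := ∃ τ, G.IsWinning₀ τ

end Game

/-! ### The delay-dominance game -/

/-- Positions of the delay-dominance game; `p` is the alternative state, `q` the dominant state
and `j` the number of the round. -/
inductive Pos (Q : Type u) : Type u
  | sEx (p q : Q) (j : ℕ) : Pos Q
  | dEx (p q : Q) (c : Set Q) (j : ℕ) : Pos Q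
  | sAll (p q : Q) (c c' : Set Q) (j : ℕ) : Pos Q
  | dAll (p q : Q) (c : Set Q) (q' : Q) (j : ℕ) : Pos Q

namespace Pos

variable {Q : Type u}

/-- The alternative state of a position. -/
def alt : Pos Q → Q
  | sEx p _ _ => p
  | dEx p _ _ _ => p
  | sAll p _ _ _ _ => p
  | dAll p _ _ _ _ => p

/-- The dominant state of a position. -/
def dom : Pos Q → Q
  | sEx _ q _ => q
  | dEx _ q _ _ => q
  | sAll _ q _ _ _ => q
  | dAll _ q _ _ _ => q

/-- The positions that are owned by Duplicator. -/
def IsDup : Pos Q → Prop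
  | sEx _ _ _ => False
  | dEx _ _ _ _ => True
  | sAll _ _ _ _ _ => False
  | dAll _ _ _ _ _ => True

end Pos

/-- Edges of the delay-dominance game: Spoiler chooses `c ∈ δ(p, σ_j)`, Duplicator chooses
`c' ∈ δ(q, σ'_j)`, Spoiler chooses `q' ∈ c'`, Duplicator chooses `p' ∈ c`. -/
inductive DDEdge {AP : Type u} {Q : Type v} [Finite Q] (A : ACA AP Q) (σ σ' : Word AP) :
    Pos Q → Pos Q → Prop
  | chooseAltSet (p q : Q) (c : Set Q) (j : ℕ) (h : c ∈ A.trans p (σ j)) :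
      DDEdge A σ σ' (.sEx p q j) (.dEx p q c j)
  | chooseDomSet (p q : Q) (c c' : Set Q) (j : ℕ) (h : c' ∈ A.trans q (σ' j)) :
      DDEdge A σ σ' (.dEx p q c j) (.sAll p q c c' j)
  | chooseDom (p q : Q) (c c' : Set Q) (q' : Q) (j : ℕ) (h : q' ∈ c') :
      DDEdge A σ σ' (.sAll p q c c' j) (.dAll p q c q' j)
  | chooseAlt (p q : Q) (c : Set Q) (q' p' : Q) (j : ℕ) (h : p' ∈ c) :
      DDEdge A σ σ' (.dAll p q c q' j) (.sEx p' q' (j + 1))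

/-- The delay-dominance game `(A, σ, σ')`; Duplicator is Player 0. -/
def ddGame {AP : Type u} {Q : Type v} [Finite Q] (A : ACA AP Q) (σ σ' : Word AP) :
    Game (Pos Q) where
  own₀ := {v | v.IsDup}
  init := .sEx A.init A.init 0
  edge := DDEdge A σ σ'
  win := {ρ | ∀ j, (ρ j).dom ∈ A.rej → ∃ j' ≥ j, (ρ j').alt ∈ A.rej}

/-! ### Process strategies and delay-dominance

A process has input variables `In` and output variables `Out`; its variables are `In ⊕ Out`. -/

/-- Strategies of a process map input histories to outputs. -/
abbrev ProcStrategy (In : Type u) (Out : Type v) := List (Set In) → Set Out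

/-- The computation of `s` on the input sequence `γ`: in step `n` it consists of the input `γ n`
and the output of `s` on the history `γ 0, …, γ (n - 1)`. -/
def comp {In : Type u} {Out : Type v} (s : ProcStrategy In Out) (γ : Word In) :
    Word (In ⊕ Out) :=
  fun n => Sum.inl '' γ n ∪ Sum.inr '' s ((List.range n).map γ)

/-- `s` delay-dominates `t` for `A` on the input sequence `γ`. -/
def DelayDominatesOn {In : Type u} {Out : Type v} {Q : Type w} [Finite Q] (A : ACA (In ⊕ Out) Q)
    (s t : ProcStrategy In Out) (γ : Word In) : Prop :=
  (ddGame A (comp t γ) (comp s γ)).Wins₀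

/-! ### Primed variables -/

/-- The variables of a process together with its primed outputs: `inl x` is the variable `x`,
`inr o` is the primed output `o'`. -/
abbrev PrVar (In : Type u) (Out : Type v) := (In ⊕ Out) ⊕ Out

/-- Priming of a variable; inputs are never primed. -/
def primeVar {In : Type u} {Out : Type v} : In ⊕ Out → PrVar In Out
  | .inl i => .inl (.inl i)
  | .inr o => .inr o

/-- Priming of a valuation. -/
def pr {In : Type u} {Out : Type v} (a : Set (In ⊕ Out)) : Set (PrVar In Out) := primeVar '' a

/-- The letter `ι̃ ∩ V`, where `V` is the set of unprimed variables. -/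
def unprimedPart {In : Type u} {Out : Type v} (a : Set (PrVar In Out)) : Set (In ⊕ Out) :=
  {x | Sum.inl x ∈ a}

/-- The letter `unpr(ι̃ ∩ V')`, where `V'` is the set of inputs and primed outputs. -/
def primedPart {In : Type u} {Out : Type v} (a : Set (PrVar In Out)) : Set (In ⊕ Out) :=
  {x | primeVar x ∈ a}

/-- The word `comp(s, γ) ∪ pr(comp(t, γ) ∩ O)`. -/
def jointWord {In : Type u} {Out : Type v} (s t : ProcStrategy In Out) (γ : Word In) :
    Word (PrVar In Out) :=
  fun n => Sum.inl '' comp s γ n ∪ pr (comp t γ n ∩ Set.range Sum.inr)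

/-! ### The automaton for delay-dominance -/

open Classical in
/-- The successor function `ϑ`; the marks `⊤` and `⊥` are `true` and `false`. -/
noncomputable def succMark {Q : Type u} (F : Set Q) (p q : Q) (m : Bool) : Q × Q × Bool :=
  if p ∉ F ∧ q ∈ F ∧ m = true then (p, q, false)
  else if p ∉ F ∧ m = false then (p, q, false)
  else (p, q, true)

/-- The formula `⋀_{c ∈ δ(p,ι')} ⋁_{c' ∈ δ(q,ι)} ⋀_{q' ∈ c'} ⋁_{p' ∈ c} ϑ(p',q',m)`, where
`a` is `ι` and `a'` is `ι'`. -/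
noncomputable def prodTrans {AP : Type u} {Q : Type v} [Finite Q] (A : ACA AP Q) (p q : Q)
    (m : Bool) (a a' : Set AP) : DNF (Q × Q × Bool) :=
  DNF.bigAnd (A.trans p a') fun c =>
    DNF.bigOr (A.trans q a) fun c' =>
      DNF.bigAnd c' fun q' =>
        DNF.bigOr c fun p' => DNF.atom (succMark A.rej p' q' m)

open Classical in
/-- The automaton `B` built from an automaton `A` for a formula and an automaton `Ac` for its
negation. -/
noncomputable def ddACA {In : Type u} {Out : Type v} {Q : Type w} {Qc : Type x}
    [Finite Q] [Finite Qc]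
    (A : ACA (In ⊕ Out) Q) (Ac : ACA (In ⊕ Out) Qc) :
    ACA (PrVar In Out) ((Q × Q × Bool) ⊕ Qc) where
  init := .inl (A.init, A.init, true)
  rej := {x | (∃ p q, x = .inl (p, q, false)) ∨ ∃ r ∈ Ac.rej, x = .inr r}
  trans
    | .inr r, a => (Ac.trans r (primedPart a)).map Sum.inr
    | .inl (p, q, m), a =>
      let D := (prodTrans A p q m (unprimedPart a) (primedPart a)).map Sum.inl
      if (p, q, m) = (A.init, A.init, true) then
        DNF.or ((Ac.trans Ac.init (primedPart a)).map Sum.inr) D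
      else D

end DelayDom

/-! The proof compares ordinal ranks of the two words. The rank is the least progress measure of the
acceptance game. At a finite rank some clause never raises the value, and it lowers the value
whenever this is a successor; rejecting states have successor ranks. A word is accepted iff its
initial rank is not `⊤` (`accepts_of_rank_ne_top`, `not_accepts_of_rank_eq_top`). The universal
player can prevent the rank from falling by more than one per step (`exists_mem_rank_le_succ`) and,
above a limit value, can force a rejecting state while a natural number counts down
(`exists_countdown`).

If Duplicator wins, the dominant rank is at most the alternative rank (`rank_le_rank_of_wins`). In a
violation with least alternative rank `α`, Spoiler plays optimally for acceptance on the alternative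
side and against it on the dominant side. Then `α` is a limit at which the alternative side stays,
seeing no rejecting state, while the dominant side is forced into one.

Given this inequality and a finite dominant rank, the pair part of the product accepts
(`ddACA_accepts_of_rank_le`): Duplicator's choices preserve the inequality, and every mark `⊥` is
paid for by a drop of the pair (dominant rank, countdown). If the dominant rank is `⊤`, both words
are rejected. Then pending visits may recur forever, and the run enters the automaton for the
negation instead.

Conversely (`wins_of_ddACA_accepts`), a run through pairs is a strategy of Duplicator, because an
unanswered visit would keep the mark `⊥` forever. If the run enters the automaton for the negation,
the remaining alternative word is rejected, so Duplicator can force rejecting alternative states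
again and again. -/

namespace DelayDom

universe u v w x

/-! ### Progress measures -/

section Rank

open Order

variable {AP : Type u} {Q : Type v} [Finite Q]

/-- Progress measures of the acceptance game of `A` on `σ`: at a position with a finite value,
some clause does not increase the value, and decreases it if the value is a successor. Rejecting
states only have successor values. -/
def IsProgressMeasure (A : ACA AP Q) (σ : Word AP) (r : Q → ℕ → WithTop Ordinal.{v}) : Prop :=
  ∀ q n, r q n ≠ ⊤ → (q ∈ A.rej → ¬ IsSuccPrelimit (r q n)) ∧
    ∃ c ∈ A.trans q (σ n), ∀ q' ∈ c, r q' (n + 1) ≤ r q n ∧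
      (¬ IsSuccPrelimit (r q n) → r q' (n + 1) < r q n)

/-- The least progress measure. -/
noncomputable def rank (A : ACA AP Q) (σ : Word AP) (q : Q) (n : ℕ) : WithTop Ordinal.{v} :=
  sInf {a | ∃ r, IsProgressMeasure A σ r ∧ r q n = a}

theorem rank_le {A : ACA AP Q} {σ : Word AP} {r : Q → ℕ → WithTop Ordinal.{v}}
    (hr : IsProgressMeasure A σ r) (q : Q) (n : ℕ) : rank A σ q n ≤ r q n :=
  sInf_le ⟨r, hr, rfl⟩

theorem exists_measure_eq_rank (A : ACA AP Q) (σ : Word AP) (q : Q) (n : ℕ) :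
    ∃ r, IsProgressMeasure A σ r ∧ r q n = rank A σ q n :=
  csInf_mem (s := {a | ∃ r, IsProgressMeasure A σ r ∧ r q n = a})
    ⟨⊤, fun _ _ => ⊤, fun _ _ h => absurd rfl h, rfl⟩

/-- A measure that attains the rank at a given position supplies the clause there; passing to the
rank only lowers the values of the successors. -/
theorem isProgressMeasure_rank (A : ACA AP Q) (σ : Word AP) :
    IsProgressMeasure A σ (rank A σ) := by
  intro q n hq
  obtain ⟨r, hr, he⟩ := exists_measure_eq_rank A σ q n
  rw [← he] at hq ⊢
  obtain ⟨h1, c, hc, h2⟩ := hr q n hq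
  exact ⟨h1, c, hc, fun q' hq' => ⟨(rank_le hr _ _).trans (h2 q' hq').1,
    fun h => (rank_le hr _ _).trans_lt ((h2 q' hq').2 h)⟩⟩

/-- The rank can be bounded by `α` on every set of positions that is consistent with that bound. -/
theorem rank_le_of_forall {A : ACA AP Q} {σ : Word AP} (S : Q → ℕ → Prop)
    (α : WithTop Ordinal.{v})
    (hS : ∀ q n, S q n → (q ∈ A.rej → ¬ IsSuccPrelimit α) ∧
      ∃ c ∈ A.trans q (σ n), ∀ q' ∈ c, (rank A σ q' (n + 1) ≤ α ∨ S q' (n + 1)) ∧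
        (¬ IsSuccPrelimit α → rank A σ q' (n + 1) < α))
    {q : Q} {n : ℕ} (hq : S q n) : rank A σ q n ≤ α := by
  classical
  -- The rank is cut down to `α` on `S`. Where this changes the value, `hS` supplies the clause;
  -- elsewhere the old clause works, as `r` is below the rank.
  set r : Q → ℕ → WithTop Ordinal.{v} :=
    fun q n => if S q n then min α (rank A σ q n) else rank A σ q n with hr
  have hle : ∀ q n, r q n ≤ rank A σ q n := by
    intro q n
    simp only [hr]
    split_ifs
    · exact min_le_right _ _
    · exact le_rfl
  have hle' : ∀ q n, S q n → r q n ≤ α := by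
    intro q n h
    simp only [hr, if_pos h]
    exact min_le_left _ _
  have hm : IsProgressMeasure A σ r := by
    intro q n hne
    by_cases hcase : r q n = rank A σ q n
    · rw [hcase] at hne ⊢
      obtain ⟨h1, c, hc, h2⟩ := isProgressMeasure_rank A σ q n hne
      exact ⟨h1, c, hc, fun q' hq' => ⟨(hle _ _).trans (h2 q' hq').1,
        fun h => (hle _ _).trans_lt ((h2 q' hq').2 h)⟩⟩
    · have hSq : S q n := by
        by_contra h
        exact hcase (by simp only [hr, if_neg h])
      have heq : r q n = α := by
        simp only [hr, if_pos hSq] at hcase ⊢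
        rcases min_choice α (rank A σ q n) with h | h
        · exact h
        · exact absurd h hcase
      rw [heq]
      obtain ⟨h1, c, hc, h2⟩ := hS q n hSq
      exact ⟨h1, c, hc, fun q' hq' => ⟨(h2 q' hq').1.elim (hle _ _).trans (hle' _ _),
        fun h => (hle _ _).trans_lt ((h2 q' hq').2 h)⟩⟩
  exact (rank_le hm q n).trans (hle' q n hq)

/-- Every clause has a state whose rank is at most one less than the rank of the position. -/
theorem exists_mem_rank_le_succ {A : ACA AP Q} (hA : A.NoConstants) {σ : Word AP} {q : Q} {n : ℕ}
    {c : Set Q} (hc : c ∈ A.trans q (σ n)) :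
    ∃ q' ∈ c, rank A σ q n ≤ succ (rank A σ q' (n + 1)) := by
  obtain ⟨q', hq', hmax⟩ := Set.exists_max_image c (fun q' => rank A σ q' (n + 1)) c.toFinite
    ((hA q (σ n)).2 c hc)
  refine ⟨q', hq', ?_⟩
  by_cases htop : rank A σ q' (n + 1) = ⊤
  · rw [htop, succ_top]
    exact le_top
  have hmx : ¬ IsMax (rank A σ q' (n + 1)) := by rwa [isMax_iff_eq_top]
  -- The successor of the largest rank in `c` is an admissible value for this single position: it is
  -- a successor, and `c` lowers it strictly.
  refine rank_le_of_forall (fun p m => p = q ∧ m = n) _ ?_ ⟨rfl, rfl⟩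
  rintro _ _ ⟨rfl, rfl⟩
  refine ⟨fun _ => fun h => hmx h.isMax, c, hc, fun p hp => ?_⟩
  have := (hmax p hp).trans_lt (lt_succ_of_not_isMax hmx)
  exact ⟨Or.inl this.le, fun _ => this⟩

/-- Above a limit value, the universal player can force a visit to a rejecting state: there is a
potential that decreases until then. -/
theorem exists_countdown (A : ACA AP Q) (σ : Word AP) {α : WithTop Ordinal.{v}}
    (hα : IsSuccPrelimit α) :
    ∃ cd : Q → ℕ → ℕ, ∀ p n, α < rank A σ p n → p ∉ A.rej → ∀ c ∈ A.trans p (σ n),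
      ∃ p' ∈ c, α < rank A σ p' (n + 1) ∧ cd p' (n + 1) < cd p n := by
  classical
  -- Attractor levels: the universal player keeps the rank above `α` and, in fewer than `k` rounds,
  -- forces a rejecting state or a position without clauses.
  let att : ℕ → Q → ℕ → Prop := fun k => k.rec (fun _ _ => False) fun _ ih p n =>
    α < rank A σ p n ∧ (p ∉ A.rej → ∀ c ∈ A.trans p (σ n), ∃ p' ∈ c, ih p' (n + 1))
  have att_rank : ∀ k p n, att k p n → α < rank A σ p n := by
    rintro (_ | k) p n h
    · exact h.elim
    · exact h.1
  have att_mono : ∀ k p n, att k p n → att (k + 1) p n := by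
    intro k
    induction k with
    | zero => exact fun _ _ h => h.elim
    | succ k ih =>
      intro p n h
      refine ⟨h.1, fun hp c hc => ?_⟩
      obtain ⟨p', hp', h'⟩ := h.2 hp c hc
      exact ⟨p', hp', ih _ _ h'⟩
  have att_mono' : ∀ {k l}, k ≤ l → ∀ p n, att k p n → att l p n := by
    intro k l hkl p n h
    induction hkl with
    | refl => exact h
    | step _ ih => exact att_mono _ _ _ ih
  have hex : ∀ p n, α < rank A σ p n → ∃ k, att k p n := by
    intro p n hp
    by_contra hno
    -- Positions outside the attractor could all be given the value `α`: none of them is rejecting,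
    -- and a limit value demands no decrease.
    refine hp.not_ge (rank_le_of_forall (fun p n => α < rank A σ p n ∧ ¬ ∃ k, att k p n) α ?_
      ⟨hp, hno⟩)
    clear hno hp p n
    rintro p n ⟨hlt, hno⟩
    have hrej : p ∉ A.rej := fun h => hno ⟨1, hlt, fun h' => absurd h h'⟩
    refine ⟨fun h => absurd h hrej, ?_⟩
    by_contra hcon
    have hk : ∀ c : Set Q, ∃ k, c ∈ A.trans p (σ n) → ∃ p' ∈ c, att k p' (n + 1) := by
      intro c
      by_contra hc
      have hc' : c ∈ A.trans p (σ n) := by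
        by_contra h
        exact hc ⟨0, fun h' => absurd h' h⟩
      refine hcon ⟨c, hc', fun p' hp' => ⟨?_, fun h => absurd hα h⟩⟩
      refine (le_or_gt _ _).imp id fun hgt => ⟨hgt, ?_⟩
      rintro ⟨k, hk⟩
      exact hc ⟨k, fun _ => ⟨p', hp', hk⟩⟩
    choose K hK using hk
    -- As `Q` is finite, there are only finitely many clauses, so their levels have a common bound.
    obtain ⟨k, hk⟩ := (Set.finite_range K).bddAbove
    refine hno ⟨k + 1, hlt, fun _ c hc => ?_⟩
    obtain ⟨p', hp', h⟩ := hK c hc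
    exact ⟨p', hp', att_mono' (hk ⟨c, rfl⟩) _ _ h⟩
  refine ⟨fun p n => sInf {k | att k p n}, fun p n hlt hp c hc => ?_⟩
  have hmem : att (sInf {k | att k p n}) p n := Nat.sInf_mem (s := {k | att k p n}) (hex p n hlt)
  cases hk : sInf {k | att k p n} with
  | zero => rw [hk] at hmem; exact hmem.elim
  | succ k =>
    rw [hk] at hmem
    obtain ⟨p', hp', h⟩ := hmem.2 hp c hc
    exact ⟨p', hp', att_rank _ _ _ h,
      (Nat.lt_succ_of_le (Nat.sInf_le (s := {k | att k p' (n + 1)}) h)).trans_eq hk.symm⟩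

/-- At positions of infinite rank, the universal player can force infinitely many visits to
rejecting states. -/
theorem exists_countdown_top {A : ACA AP Q} (hA : A.NoConstants) (σ : Word AP) :
    ∃ cd : Q → ℕ → ℕ, ∀ p n, rank A σ p n = ⊤ → ∀ c ∈ A.trans p (σ n),
      ∃ p' ∈ c, rank A σ p' (n + 1) = ⊤ ∧ (p ∉ A.rej → cd p' (n + 1) < cd p n) := by
  -- With `b` above all finite ranks, `b + ω` is a limit value that only the rank `⊤` exceeds.
  obtain ⟨b, hb⟩ := Ordinal.bddAbove_of_small
    (s := Set.range fun x : Q × ℕ => (rank A σ x.1 x.2).untopD 0)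
  have hlim : IsSuccPrelimit ((b + Ordinal.omega0 : Ordinal.{v}) : WithTop Ordinal.{v}) := by
    intro a ha
    obtain ⟨a', rfl⟩ := WithTop.ne_top_iff_exists.1 ha.lt.ne_top
    exact (Ordinal.isSuccLimit_add b Ordinal.isSuccLimit_omega0).isSuccPrelimit a'
      ⟨WithTop.coe_lt_coe.1 ha.1, fun c h1 h2 =>
        ha.2 (WithTop.coe_lt_coe.2 h1) (WithTop.coe_lt_coe.2 h2)⟩
  have htop : ∀ q n, ((b + Ordinal.omega0 : Ordinal.{v}) : WithTop Ordinal.{v}) < rank A σ q n →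
      rank A σ q n = ⊤ := by
    intro q n h
    by_contra hne
    obtain ⟨a, ha⟩ := WithTop.ne_top_iff_exists.1 hne
    have h1 := hb ⟨(q, n), rfl⟩
    simp only [← ha, WithTop.untopD_coe] at h1
    rw [← ha, WithTop.coe_lt_coe] at h
    exact (h1.trans le_self_add).not_gt h
  obtain ⟨cd, hcd⟩ := exists_countdown A σ hlim
  refine ⟨cd, fun p n hp c hc => ?_⟩
  by_cases hrej : p ∈ A.rej
  · obtain ⟨p', hp', h⟩ := exists_mem_rank_le_succ hA hc
    refine ⟨p', hp', ?_, fun h => absurd hrej h⟩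
    rw [hp, top_le_iff] at h
    by_contra hne
    obtain ⟨a, ha⟩ := WithTop.ne_top_iff_exists.1 hne
    rw [← ha, WithTop.succ_coe] at h
    exact WithTop.coe_ne_top h
  · obtain ⟨p', hp', h1, h2⟩ := hcd p n (hp ▸ WithTop.coe_lt_top _) hrej c hc
    exact ⟨p', hp', htop _ _ h1, fun _ => h2⟩

/-- Of two values `a ≤ b`, the smaller one stays below if it decreases at successors while the
larger one decreases at most to its predecessor. -/
theorem le_of_le_of_le_succ {L : Type*} [LinearOrder L] [SuccOrder L] {a a' b b' : L}
    (hab : a ≤ b) (ha : a' ≤ a) (ha' : ¬ IsSuccPrelimit a → a' < a) (hb : b ≤ succ b') :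
    a' ≤ b' := by
  by_contra! h
  have h1 : succ b' ≤ a' := succ_le_of_lt h
  have h2 : a = succ b' := le_antisymm (hab.trans hb) (h1.trans ha)
  have h3 : ¬ IsSuccPrelimit a := by
    rw [h2]
    exact fun h' => (h.trans_le (ha.trans h2.le)).not_ge (h'.isMax (le_succ b'))
  exact ((ha' h3).trans_le h2.le).not_ge h1

/-- A sequence that does not increase in a well-order decreases only finitely often. -/
theorem finite_setOf_lt_of_antitone {L : Type*} [LinearOrder L] [WellFoundedLT L] {f : ℕ → L}
    (hf : ∀ n, f (n + 1) ≤ f n) : {n | f (n + 1) < f n}.Finite := by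
  obtain ⟨N, hN⟩ := WellFounded.has_min (wellFounded_lt (α := L)) (Set.range f) ⟨_, 0, rfl⟩
  obtain ⟨⟨N, rfl⟩, hN⟩ := hN
  refine (Set.finite_lt_nat N).subset fun n hn => ?_
  by_contra h
  exact hN _ ⟨n + 1, rfl⟩ (hn.trans_le (antitone_nat_of_succ_le hf (not_lt.1 h)))

/-- A sequence of states with a potential that decreases at all states outside of `F` visits `F`
infinitely often. -/
theorem exists_ge_mem_of_countdown {Q : Type*} {F : Set Q} {p : ℕ → Q} {g : ℕ → ℕ} {N : ℕ}
    (h : ∀ n ≥ N, p n ∉ F → g (n + 1) < g n) {j : ℕ} (hj : N ≤ j) : ∃ n ≥ j, p n ∈ F := by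
  induction hk : g j using Nat.strong_induction_on generalizing j with
  | _ k ih =>
    by_cases hF : p j ∈ F
    · exact ⟨j, le_rfl, hF⟩
    · obtain ⟨n, hn, h'⟩ := ih (g (j + 1)) (hk ▸ h j hj hF) (by omega) rfl
      exact ⟨n, by omega, h'⟩

end Rank

/-! ### Acceptance through transition systems -/

section Accepts

variable {AP : Type u} {Q : Type v} [Finite Q]

/-- Acceptance from a transition system whose states generate a run tree: `I n` is an invariant
of the states at level `n`, `R n` the transition relation from level `n` to level `n + 1`. -/
theorem accepts_of_system (A : ACA AP Q) (σ : Word AP) {H : Type w} (lab : H → Q)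
    (I : ℕ → H → Prop) (R : ℕ → H → H → Prop) (h₀ : H) (hI : I 0 h₀) (hlab : lab h₀ = A.init)
    (hstep : ∀ n h, I n h → ∃ C ∈ A.trans (lab h) (σ n), ∀ q ∈ C,
      ∃ h', I (n + 1) h' ∧ R n h h' ∧ lab h' = q)
    (hacc : ∀ f : ℕ → H, f 0 = h₀ → (∀ n, I n (f n) ∧ R n (f n) (f (n + 1))) →
      {n | lab (f n) ∈ A.rej}.Finite) : A.Accepts σ := by
  classical
  let S := {y : ℕ × H // I y.1 y.2}
  have hstep' : ∀ y : S, ∃ C ∈ A.trans (lab y.1.2) (σ y.1.1), ∀ q ∈ C,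
      ∃ z : S, z.1.1 = y.1.1 + 1 ∧ R y.1.1 y.1.2 z.1.2 ∧ lab z.1.2 = q := by
    rintro ⟨⟨n, h⟩, hn⟩
    obtain ⟨C, hC, h2⟩ := hstep n h hn
    refine ⟨C, hC, fun q hq => ?_⟩
    obtain ⟨h', h3, h4⟩ := h2 q hq
    exact ⟨⟨(n + 1, h'), h3⟩, rfl, h4⟩
  choose C hC nx hnx using hstep'
  -- A child is addressed by the code of its label, so a tree address determines a path of the
  -- system; `none` stands for addresses outside the tree.
  obtain ⟨e, he⟩ := Countable.exists_injective_nat Q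
  let next : S → ℕ → Option S := fun y d =>
    if h : ∃ q, q ∈ C y ∧ e q = d then some (nx y h.choose h.choose_spec.1) else none
  have next_some : ∀ y q (hq : q ∈ C y), next y (e q) = some (nx y q hq) := by
    intro y q hq
    have h : ∃ q', q' ∈ C y ∧ e q' = e q := ⟨q, hq, rfl⟩
    have h' : h.choose = q := he h.choose_spec.2
    simp only [next, dif_pos h, h']
  have of_next : ∀ y d z, next y d = some z → ∃ q, ∃ hq : q ∈ C y, z = nx y q hq := by
    intro y d z h
    simp only [next] at h
    split_ifs at h with h'
    exact ⟨_, h'.choose_spec.1, (Option.some.inj h).symm⟩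
  let node : List ℕ → Option S :=
    List.foldl (fun o d => o.bind fun y => next y d) (some ⟨(0, h₀), hI⟩)
  have node_snoc : ∀ x d, node (x ++ [d]) = (node x).bind fun y => next y d := by
    intro x d
    simp only [node, List.foldl_append, List.foldl_cons, List.foldl_nil]
  have node_length : ∀ x y, node x = some y → y.1.1 = x.length := by
    intro x
    induction x using List.reverseRecOn with
    | nil =>
      intro y hy
      rw [← Option.some.inj hy]
      rfl
    | append_singleton x d ih =>
      intro y hy
      rw [node_snoc] at hy
      obtain ⟨z, hz, hy⟩ := Option.bind_eq_some_iff.1 hy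
      obtain ⟨q, hq, rfl⟩ := of_next _ _ _ hy
      rw [(hnx z q hq).1, ih z hz, List.length_append, List.length_singleton]
  let ℓ : List ℕ → Q := fun x => ((node x).map fun y => lab y.1.2).getD A.init
  have ℓ_eq : ∀ x y, node x = some y → ℓ x = lab y.1.2 := by
    intro x y h
    simp only [ℓ, h, Option.map_some, Option.getD_some]
  refine ⟨{x | ∃ y, node x = some y}, ℓ, ⟨⟨_, rfl⟩, ?_, ?_, ?_⟩, ?_⟩
  · rintro x _ ⟨t, rfl⟩
    induction t using List.reverseRecOn with
    | nil => exact fun h => by simpa using h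
    | append_singleton t d ih =>
      rintro ⟨y, hy⟩
      rw [← List.append_assoc, node_snoc] at hy
      obtain ⟨z, hz, -⟩ := Option.bind_eq_some_iff.1 hy
      exact ih ⟨z, hz⟩
  · rw [ℓ_eq [] _ rfl, hlab]
  · rintro x ⟨y, hy⟩
    rw [ℓ_eq x y hy, ← node_length x y hy]
    refine Set.mem_of_eq_of_mem (Set.ext fun q => ⟨?_, fun hq => ?_⟩) (hC y)
    · rintro ⟨d, ⟨z, hz⟩, rfl⟩
      rw [ℓ_eq _ _ hz]
      rw [node_snoc, hy] at hz
      obtain ⟨q, hq, rfl⟩ := of_next _ _ _ hz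
      rwa [(hnx y q hq).2.2]
    · have h : node (x ++ [e q]) = some (nx y q hq) := by
        rw [node_snoc, hy, Option.bind_some, next_some y q hq]
      exact ⟨e q, ⟨_, h⟩, (ℓ_eq _ _ h).trans (hnx y q hq).2.2⟩
  · rintro b ⟨hb0, hb⟩
    choose y hy using fun n => (hb n).1
    choose d hd using fun n => (hb n).2
    have hlen : ∀ n, (b n).length = n := by
      intro n
      induction n with
      | zero => rw [hb0, List.length_nil]
      | succ n ih => rw [hd, List.length_append, ih, List.length_singleton]
    have hyn : ∀ n, (y n).1.1 = n := fun n => (node_length _ _ (hy n)).trans (hlen n)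
    have hfin := hacc (fun n => (y n).1.2) ?_ fun n => ⟨?_, ?_⟩
    · refine hfin.subset fun n hn => ?_
      have hn' : ℓ (b n) ∈ A.rej := hn
      rwa [ℓ_eq _ _ (hy n)] at hn'
    · have h := hy 0
      rw [hb0] at h
      rw [← Option.some.inj h]
    · have h := (y n).2
      rwa [hyn n] at h
    · have h := hy (n + 1)
      rw [hd, node_snoc, hy n] at h
      obtain ⟨q, hq, h⟩ := of_next _ _ _ h
      have h' := (hnx (y n) q hq).2.1
      rwa [hyn n, ← h] at h'

/-- Along the clauses of the least measure the rank never increases, and it drops after every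
rejecting state because rejecting states have successor ranks. -/
theorem accepts_of_rank_ne_top (A : ACA AP Q) (σ : Word AP) (h : rank A σ A.init 0 ≠ ⊤) :
    A.Accepts σ := by
  refine accepts_of_system A σ (fun q => q) (fun n q => rank A σ q n ≠ ⊤)
    (fun n q q' => rank A σ q' (n + 1) ≤ rank A σ q n ∧
      (q ∈ A.rej → rank A σ q' (n + 1) < rank A σ q n)) A.init h rfl ?_ ?_
  · intro n q hq
    obtain ⟨h1, c, hc, h2⟩ := isProgressMeasure_rank A σ q n hq
    exact ⟨c, hc, fun q' hq' => ⟨q', ((h2 q' hq').1.trans_lt hq.lt_top).ne,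
      ⟨(h2 q' hq').1, fun hF => (h2 q' hq').2 (h1 hF)⟩, rfl⟩⟩
  · intro f _ hf
    exact (finite_setOf_lt_of_antitone (f := fun n => rank A σ (f n) n)
      fun n => (hf n).2.1).subset fun n hn => (hf n).2.2 hn

/-- In any run tree the countdown selects a branch of positions of rank `⊤`. It cannot decrease
forever, so rejecting states recur. -/
theorem not_accepts_of_rank_eq_top {A : ACA AP Q} (hA : A.NoConstants) {σ : Word AP}
    (h : rank A σ A.init 0 = ⊤) : ¬ A.Accepts σ := by
  rintro ⟨T, ℓ, hT, hfin⟩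
  obtain ⟨cd, hcd⟩ := exists_countdown_top hA σ
  let S := {x : List ℕ // x ∈ T ∧ rank A σ (ℓ x) x.length = ⊤}
  have hstep : ∀ x : S, ∃ y : S, (∃ d : ℕ, y.1 = x.1 ++ [d]) ∧
      (ℓ x.1 ∉ A.rej → cd (ℓ y.1) y.1.length < cd (ℓ x.1) x.1.length) := by
    rintro ⟨x, hx, hr⟩
    obtain ⟨_, ⟨d, hd, rfl⟩, h1, h2⟩ := hcd _ _ hr _ (hT.children x hx)
    have hl : (x ++ [d]).length = x.length + 1 := by simp
    exact ⟨⟨x ++ [d], hd, by rwa [hl]⟩, ⟨d, rfl⟩, fun h => by simpa only [hl] using h2 h⟩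
  choose nx hnx using hstep
  let b : ℕ → S := fun n => nx^[n] ⟨[], hT.root_mem, by rwa [hT.root_label]⟩
  have hb : ∀ n, b (n + 1) = nx (b n) := fun n => Function.iterate_succ_apply' _ _ _
  have hF := hfin (fun n => (b n).1) ⟨rfl, fun n => ⟨(b n).2.1, by
    simp only [hb]
    exact (hnx (b n)).1⟩⟩
  obtain ⟨N, hN⟩ := hF.bddAbove
  obtain ⟨n, hn, hn'⟩ := exists_ge_mem_of_countdown (F := A.rej) (p := fun n => ℓ (b n).1)
    (g := fun n => cd (ℓ (b n).1) (b n).1.length) (N := 0)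
    (fun n _ h => by
      simp only [hb]
      exact (hnx (b n)).2 h) (Nat.zero_le (N + 1))
  have := hN hn'
  omega

end Accepts

/-! ### Winning strategies of Duplicator through transition systems -/

section Systems

variable {AP : Type u} {Q : Type v} [Finite Q]

/-- Duplicator wins if some transition system answers all moves of Spoiler and all its infinite
paths are won by Duplicator. `I n` is an invariant of the states before round `n`, `R n` is the
transition relation of round `n`. -/
theorem wins_of_system (A : ACA AP Q) (σ σ' : Word AP) {H : Type w} (alt dom : H → Q)
    (I : ℕ → H → Prop) (R : ℕ → H → H → Prop) (h₀ : H) (hI : I 0 h₀)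
    (halt : alt h₀ = A.init) (hdom : dom h₀ = A.init)
    (hstep : ∀ n h, I n h → ∀ c ∈ A.trans (alt h) (σ n), ∃ c' ∈ A.trans (dom h) (σ' n),
      ∀ q' ∈ c', ∃ h', I (n + 1) h' ∧ R n h h' ∧ alt h' ∈ c ∧ dom h' = q')
    (hwin : ∀ f : ℕ → H, f 0 = h₀ → (∀ n, I n (f n) ∧ R n (f n) (f (n + 1))) →
      ∀ j, dom (f j) ∈ A.rej → ∃ j' ≥ j, alt (f j') ∈ A.rej) :
    (ddGame A σ σ').Wins₀ := by
  classical
  have hstep' : ∀ n h c, ∃ c', I n h → c ∈ A.trans (alt h) (σ n) → c' ∈ A.trans (dom h) (σ' n) ∧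
      ∀ q' ∈ c', ∃ h', I (n + 1) h' ∧ R n h h' ∧ alt h' ∈ c ∧ dom h' = q' := by
    intro n h c
    by_cases hc : I n h ∧ c ∈ A.trans (alt h) (σ n)
    · obtain ⟨c', h1, h2⟩ := hstep n h hc.1 c hc.2
      exact ⟨c', fun _ _ => ⟨h1, h2⟩⟩
    · exact ⟨∅, fun h1 h2 => absurd ⟨h1, h2⟩ hc⟩
  choose cl hcl using hstep'
  have hnext : ∀ n h c q', ∃ h', I n h → c ∈ A.trans (alt h) (σ n) → q' ∈ cl n h c →
      I (n + 1) h' ∧ R n h h' ∧ alt h' ∈ c ∧ dom h' = q' := by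
    intro n h c q'
    by_cases hc : I n h ∧ c ∈ A.trans (alt h) (σ n) ∧ q' ∈ cl n h c
    · obtain ⟨h', h2⟩ := (hcl n h c hc.1 hc.2.1).2 q' hc.2.2
      exact ⟨h', fun _ _ _ => h2⟩
    · exact ⟨h₀, fun h1 h2 h3 => absurd ⟨h1, h2, h3⟩ hc⟩
  choose nx hnx using hnext
  -- The state changes only at a `dAll` position, where both `c` and `q'` are known. Duplicator's
  -- choice of `p'` is then read off the new state.
  let upd : H → Pos Q → H := fun h v => match v with
    | .dAll _ _ c q' j => nx j h c q'
    | _ => h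
  let cand : H → Pos Q → Pos Q := fun h v => match v with
    | .dEx p q c j => .sAll p q c (cl j h c) j
    | .dAll _ _ _ q' j => .sEx (alt h) q' (j + 1)
    | v => v
  -- A strategy must be legal on every history, also on inconsistent ones; there an arbitrary edge
  -- replaces the intended move.
  let move : H → Pos Q → Pos Q := fun h v =>
    if DDEdge A σ σ' v (cand h v) then cand h v
    else if h' : ∃ v', DDEdge A σ σ' v v' then h'.choose else v
  have move_edge : ∀ h v, (∃ v', DDEdge A σ σ' v v') → DDEdge A σ σ' v (move h v) := by
    intro h v hv
    simp only [move]
    split_ifs with h1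
    · exact h1
    · exact hv.choose_spec
  have move_eq : ∀ h v, DDEdge A σ σ' v (cand h v) → move h v = cand h v :=
    fun h v hv => if_pos hv
  let τ : List (Pos Q) → Pos Q := fun L =>
    match L.getLast? with
    | none => (ddGame A σ σ').init
    | some v => move (L.foldl upd h₀) v
  have τ_snoc : ∀ L v, τ (L ++ [v]) = move ((L ++ [v]).foldl upd h₀) v := by
    intro L v
    simp only [τ, List.getLast?_append, List.getLast?_singleton, Option.some_or]
  refine ⟨τ, fun L v _ hv => ?_, fun ρ hplay hinit hcons => ?_⟩
  · rw [τ_snoc]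
    exact move_edge _ _ hv
  let st : ℕ → H := fun k => ((List.range (k + 1)).map ρ).foldl upd h₀
  have st_succ : ∀ k, st (k + 1) = upd (st k) (ρ (k + 1)) := by
    intro k
    simp only [st]
    rw [List.range_succ (n := k + 1), List.map_append, List.foldl_append]
    rfl
  have hmove : ∀ k, (ρ k).IsDup → ρ (k + 1) = move (st k) (ρ k) := by
    intro k hk
    rw [hcons k hk, List.range_succ, List.map_append, List.map_singleton, τ_snoc]
    simp only [st, List.range_succ, List.map_append, List.map_singleton]
  have hround : ∀ n, ρ (4 * n) = .sEx (alt (st (4 * n))) (dom (st (4 * n))) n →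
      I n (st (4 * n)) →
      (∀ i < 4, (ρ (4 * n + i)).alt = alt (st (4 * n)) ∧
        (ρ (4 * n + i)).dom = dom (st (4 * n))) ∧
      ρ (4 * (n + 1)) = .sEx (alt (st (4 * (n + 1)))) (dom (st (4 * (n + 1)))) (n + 1) ∧
      I (n + 1) (st (4 * (n + 1))) ∧ R n (st (4 * n)) (st (4 * (n + 1))) := by
    intro n h0 hn
    set h := st (4 * n) with hh
    obtain ⟨c, hc, h1⟩ : ∃ c ∈ A.trans (alt h) (σ n), ρ (4 * n + 1) = .dEx (alt h) (dom h) c n := by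
      have e := hplay (4 * n)
      rw [h0] at e
      generalize ρ (4 * n + 1) = v at e ⊢
      cases e with
      | chooseAltSet _ _ c _ hc => exact ⟨c, hc, rfl⟩
    have s1 : st (4 * n + 1) = h := by
      rw [st_succ, h1]
    obtain ⟨hc', hq'⟩ := hcl n h c hn hc
    have h2 : ρ (4 * n + 2) = .sAll (alt h) (dom h) c (cl n h c) n := by
      rw [hmove (4 * n + 1) (by rw [h1]; trivial), h1, s1]
      exact move_eq _ _ (.chooseDomSet _ _ _ _ _ hc')
    have s2 : st (4 * n + 2) = h := by
      rw [st_succ, h2]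
      exact s1
    obtain ⟨q', hq, h3⟩ : ∃ q' ∈ cl n h c, ρ (4 * n + 3) = .dAll (alt h) (dom h) c q' n := by
      have e := hplay (4 * n + 2)
      rw [h2] at e
      change DDEdge A σ σ' _ (ρ (4 * n + 3)) at e
      generalize ρ (4 * n + 3) = v at e ⊢
      cases e with
      | chooseDom _ _ _ _ q' _ hq => exact ⟨q', hq, rfl⟩
    have s3 : st (4 * n + 3) = nx n h c q' := by
      rw [st_succ, h3, s2]
    obtain ⟨g1, g2, g3, g4⟩ := hnx n h c q' hn hc hq
    have h4 : ρ (4 * n + 4) = .sEx (alt (nx n h c q')) q' (n + 1) := by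
      rw [hmove (4 * n + 3) (by rw [h3]; trivial), h3, s3]
      exact move_eq _ _ (.chooseAlt _ _ _ _ _ _ g3)
    have s4 : st (4 * n + 4) = nx n h c q' := by
      rw [st_succ, h4]
      exact s3
    refine ⟨?_, ?_, ?_, ?_⟩
    · intro i hi
      interval_cases i
      · rw [Nat.add_zero, h0]; exact ⟨rfl, rfl⟩
      · rw [h1]; exact ⟨rfl, rfl⟩
      · rw [h2]; exact ⟨rfl, rfl⟩
      · rw [h3]; exact ⟨rfl, rfl⟩
    · rw [Nat.mul_add, Nat.mul_one, s4, h4, g4]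
    · rw [Nat.mul_add, Nat.mul_one, s4]; exact g1
    · rw [Nat.mul_add, Nat.mul_one, s4]; exact g2
  have hinv : ∀ n, ρ (4 * n) = .sEx (alt (st (4 * n))) (dom (st (4 * n))) n ∧
      I n (st (4 * n)) := by
    intro n
    induction n with
    | zero =>
      have hst : st 0 = h₀ := by
        change upd h₀ (ρ 0) = h₀
        rw [hinit]
        rfl
      rw [Nat.mul_zero, hst, halt, hdom]
      exact ⟨hinit, hI⟩
    | succ n ih =>
      obtain ⟨-, h1, h2, -⟩ := hround n ih.1 ih.2
      exact ⟨h1, h2⟩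
  have hst : st (4 * 0) = h₀ := by
    change upd h₀ (ρ 0) = h₀
    rw [hinit]
    rfl
  have hw := hwin (fun n => st (4 * n)) hst
    fun n => ⟨(hinv n).2, (hround n (hinv n).1 (hinv n).2).2.2.2⟩
  intro j hj
  have hd := ((hround (j / 4) (hinv _).1 (hinv _).2).1 (j % 4) (Nat.mod_lt _ (by norm_num))).2
  rw [Nat.div_add_mod] at hd
  rw [hd] at hj
  obtain ⟨n, hn, hF⟩ := hw _ hj
  -- The last position of round `n` is taken, since `j` may lie inside that same round.
  refine ⟨4 * n + 3, by omega, ?_⟩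
  rw [((hround n (hinv n).1 (hinv n).2).1 3 (by norm_num)).1]
  exact hF

/-- A winning strategy of Duplicator yields a transition system that answers all moves of
Spoiler. -/
theorem exists_system_of_wins {A : ACA AP Q} (hA : A.NoConstants) {σ σ' : Word AP}
    (hw : (ddGame A σ σ').Wins₀) :
    ∃ (H : Type v) (alt dom : H → Q) (R : ℕ → H → H → Prop) (h₀ : H),
      alt h₀ = A.init ∧ dom h₀ = A.init ∧
      (∀ n h, ∀ c ∈ A.trans (alt h) (σ n), ∃ c' ∈ A.trans (dom h) (σ' n),
        ∀ q' ∈ c', ∃ h', R n h h' ∧ alt h' ∈ c ∧ dom h' = q') ∧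
      ∀ f : ℕ → H, f 0 = h₀ → (∀ n, R n (f n) (f (n + 1))) →
        ∀ j, dom (f j) ∈ A.rej → ∃ j' ≥ j, alt (f j') ∈ A.rej := by
  obtain ⟨τ, hτ, hwin⟩ := hw
  -- A state is the history before the round together with the current pair. The equations for `τ`
  -- make every path of `R` spell out a consistent play.
  let R : ℕ → List (Pos Q) × Q × Q → List (Pos Q) × Q × Q → Prop := fun n h h' =>
    ∃ c c', c ∈ A.trans h.2.1 (σ n) ∧ c' ∈ A.trans h.2.2 (σ' n) ∧ h'.2.2 ∈ c' ∧ h'.2.1 ∈ c ∧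
      τ (h.1 ++ [.sEx h.2.1 h.2.2 n] ++ [.dEx h.2.1 h.2.2 c n]) = .sAll h.2.1 h.2.2 c c' n ∧
      τ (h.1 ++ [.sEx h.2.1 h.2.2 n] ++ [.dEx h.2.1 h.2.2 c n] ++ [.sAll h.2.1 h.2.2 c c' n] ++
        [.dAll h.2.1 h.2.2 c h'.2.2 n]) = .sEx h'.2.1 h'.2.2 (n + 1) ∧
      h'.1 = h.1 ++ [.sEx h.2.1 h.2.2 n] ++ [.dEx h.2.1 h.2.2 c n] ++
        [.sAll h.2.1 h.2.2 c c' n] ++ [.dAll h.2.1 h.2.2 c h'.2.2 n]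
  refine ⟨List (Pos Q) × Q × Q, fun h => h.2.1, fun h => h.2.2, R, ([], A.init, A.init), rfl, rfl,
    ?_, ?_⟩
  · rintro n ⟨L, p, q⟩ c hc
    obtain ⟨c₀, hc₀⟩ := (hA q (σ' n)).1
    have e1 : DDEdge A σ σ' (.dEx p q c n) (τ (L ++ [.sEx p q n] ++ [.dEx p q c n])) :=
      hτ (L ++ [Pos.sEx p q n]) (.dEx p q c n) trivial ⟨_, .chooseDomSet _ _ _ _ _ hc₀⟩
    obtain ⟨c', hc', h1⟩ : ∃ c' ∈ A.trans q (σ' n),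
        τ (L ++ [.sEx p q n] ++ [.dEx p q c n]) = .sAll p q c c' n := by
      generalize τ (L ++ [.sEx p q n] ++ [.dEx p q c n]) = v at e1 ⊢
      cases e1 with
      | chooseDomSet _ _ _ c' _ h => exact ⟨c', h, rfl⟩
    refine ⟨c', hc', fun q' hq' => ?_⟩
    obtain ⟨p₀, hp₀⟩ := (hA p (σ n)).2 c hc
    have e2 : DDEdge A σ σ' (.dAll p q c q' n) (τ (L ++ [.sEx p q n] ++ [.dEx p q c n] ++
        [.sAll p q c c' n] ++ [.dAll p q c q' n])) :=
      hτ _ (.dAll p q c q' n) trivial ⟨_, .chooseAlt _ _ _ _ _ _ hp₀⟩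
    obtain ⟨p', hp', h2⟩ : ∃ p' ∈ c, τ (L ++ [.sEx p q n] ++ [.dEx p q c n] ++
        [.sAll p q c c' n] ++ [.dAll p q c q' n]) = .sEx p' q' (n + 1) := by
      generalize τ (L ++ [.sEx p q n] ++ [.dEx p q c n] ++
        [.sAll p q c c' n] ++ [.dAll p q c q' n]) = v at e2 ⊢
      cases e2 with
      | chooseAlt _ _ _ _ p' _ h => exact ⟨p', h, rfl⟩
    exact ⟨(L ++ [.sEx p q n] ++ [.dEx p q c n] ++ [.sAll p q c c' n] ++ [.dAll p q c q' n], p', q'),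
      ⟨c, c', hc, hc', hq', hp', h1, h2, rfl⟩, hp', rfl⟩
  · intro f hf0 hf
    choose c c' hc hc' hq hp h1 h2 h3 using hf
    let p : ℕ → Q := fun n => (f n).2.1
    let q : ℕ → Q := fun n => (f n).2.2
    let blk : ℕ → ℕ → Pos Q := fun n i => match i with
      | 0 => .sEx (p n) (q n) n
      | 1 => .dEx (p n) (q n) (c n) n
      | 2 => .sAll (p n) (q n) (c n) (c' n) n
      | _ => .dAll (p n) (q n) (c n) (q (n + 1)) n
    let ρ : ℕ → Pos Q := fun k => blk (k / 4) (k % 4)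
    have hρ : ∀ n i, i < 4 → ρ (4 * n + i) = blk n i := by
      intro n i hi
      simp only [ρ]
      rw [show (4 * n + i) / 4 = n by omega, show (4 * n + i) % 4 = i by omega]
    have r0 : ∀ n, ρ (4 * n) = .sEx (p n) (q n) n := fun n => hρ n 0 (by norm_num)
    have r1 : ∀ n, ρ (4 * n + 1) = .dEx (p n) (q n) (c n) n := fun n => hρ n 1 (by norm_num)
    have r2 : ∀ n, ρ (4 * n + 2) = .sAll (p n) (q n) (c n) (c' n) n :=
      fun n => hρ n 2 (by norm_num)
    have r3 : ∀ n, ρ (4 * n + 3) = .dAll (p n) (q n) (c n) (q (n + 1)) n :=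
      fun n => hρ n 3 (by norm_num)
    have r4 : ∀ n, ρ (4 * n + 4) = .sEx (p (n + 1)) (q (n + 1)) (n + 1) := fun n => r0 (n + 1)
    have hist : ∀ n, (List.range (4 * n)).map ρ = (f n).1 := by
      intro n
      induction n with
      | zero => rw [hf0]; rfl
      | succ n ih =>
        rw [h3, ← ih, Nat.mul_add, Nat.mul_one]
        change List.map ρ (List.range (4 * n + 1 + 1 + 1 + 1)) = _
        simp only [List.range_succ, List.map_append, List.map_singleton, r0, r1, r2, r3]
        rfl
    have hsplit : ∀ (P : ℕ → Prop), (∀ n, P (4 * n)) → (∀ n, P (4 * n + 1)) →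
        (∀ n, P (4 * n + 2)) → (∀ n, P (4 * n + 3)) → ∀ k, P k := by
      intro P g0 g1 g2 g3 k
      obtain h | h | h | h : k % 4 = 0 ∨ k % 4 = 1 ∨ k % 4 = 2 ∨ k % 4 = 3 := by omega
      · have := g0 (k / 4); rwa [show 4 * (k / 4) = k by omega] at this
      · have := g1 (k / 4); rwa [show 4 * (k / 4) + 1 = k by omega] at this
      · have := g2 (k / 4); rwa [show 4 * (k / 4) + 2 = k by omega] at this
      · have := g3 (k / 4); rwa [show 4 * (k / 4) + 3 = k by omega] at this
    have hplay : (ddGame A σ σ').IsPlay ρ := by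
      refine hsplit _ (fun n => ?_) (fun n => ?_) (fun n => ?_) (fun n => ?_)
      · rw [r0, r1]; exact .chooseAltSet _ _ _ _ (hc n)
      · rw [r1, r2]; exact .chooseDomSet _ _ _ _ _ (hc' n)
      · rw [r2, r3]; exact .chooseDom _ _ _ _ _ _ (hq n)
      · rw [r3, r4]; exact .chooseAlt _ _ _ _ _ _ (hp n)
    have hcons : (ddGame A σ σ').Consistent₀ τ ρ := by
      refine hsplit _ (fun n => ?_) (fun n => ?_) (fun n => ?_) (fun n => ?_)
      · rw [r0]; exact fun h => h.elim
      · intro _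
        simp only [List.range_succ, List.map_append, List.map_singleton, hist, r0, r1]
        exact (r2 n).trans (h1 n).symm
      · rw [r2]; exact fun h => h.elim
      · intro _
        change _ = τ (List.map ρ (List.range (4 * n + 1 + 1 + 1 + 1)))
        simp only [List.range_succ, List.map_append, List.map_singleton, hist]
        change ρ (4 * n + 4) = τ ((f n).1 ++ [ρ (4 * n)] ++ [ρ (4 * n + 1)] ++ [ρ (4 * n + 2)] ++
          [ρ (4 * n + 3)])
        rw [r0, r1, r2, r3, r4]
        exact (h2 n).symm
    have hρ0 : ρ 0 = (ddGame A σ σ').init := by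
      change Pos.sEx (f 0).2.1 (f 0).2.2 0 = _
      rw [hf0]
      rfl
    have hw := hwin ρ hplay hρ0 hcons
    intro j hj
    obtain ⟨k, hk, hF⟩ := hw (4 * j) (by rw [r0]; exact hj)
    have halt : ∀ k, (ρ k).alt = p (k / 4) := by
      intro k
      simp only [ρ, blk]
      split <;> rfl
    rw [halt] at hF
    exact ⟨k / 4, by omega, hF⟩

end Systems

/-! ### Ranks in won delay-dominance games -/

section Duel

open Order

/-- `h` is reachable from `h₀` in exactly `n` steps. -/
inductive Reach {H : Type w} (R : ℕ → H → H → Prop) (h₀ : H) : ℕ → H → Prop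
  | zero : Reach R h₀ 0 h₀
  | succ {n : ℕ} {h h' : H} : Reach R h₀ n h → R n h h' → Reach R h₀ (n + 1) h'

/-- The winning condition speaks only of paths from `h₀`; this turns a path from a reachable state
into one of them. -/
theorem Reach.exists_path {H : Type w} {R : ℕ → H → H → Prop} {h₀ h : H} {n : ℕ}
    (hr : Reach R h₀ n h) (t : ℕ → H) (ht₀ : t 0 = h) (ht : ∀ i, R (n + i) (t i) (t (i + 1))) :
    ∃ g : ℕ → H, g 0 = h₀ ∧ (∀ i, R i (g i) (g (i + 1))) ∧ ∀ i, g (n + i) = t i := by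
  induction hr generalizing t with
  | zero => exact ⟨t, ht₀, fun i => by simpa using ht i, fun i => by rw [Nat.zero_add]⟩
  | @succ n h h' _ hR ih =>
    obtain ⟨g, h1, h2, h3⟩ := ih (fun i => i.casesOn h t) rfl (by
      rintro (_ | i)
      · change R (n + 0) h (t 0)
        rwa [ht₀]
      · have := ht i
        rwa [show n + 1 + i = n + (i + 1) by omega] at this)
    refine ⟨g, h1, h2, fun i => ?_⟩
    rw [show n + 1 + i = n + (i + 1) by omega]
    exact h3 (i + 1)

/-- A reachable state of a set `K` that can always be stayed in lies on a path from `h₀` that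
stays in `K` afterwards. -/
theorem Reach.exists_path_of_forall {H : Type w} {R : ℕ → H → H → Prop} {h₀ h : H} {n : ℕ}
    (hr : Reach R h₀ n h) (K : ℕ → H → Prop) (hK : ∀ m h, K m h → ∃ h', R m h h' ∧ K (m + 1) h')
    (hn : K n h) :
    ∃ g : ℕ → H, g 0 = h₀ ∧ (∀ i, R i (g i) (g (i + 1))) ∧ g n = h ∧ ∀ m ≥ n, K m (g m) := by
  have hK' : ∀ m h, ∃ h', K m h → R m h h' ∧ K (m + 1) h' := by
    intro m h
    by_cases hm : K m h
    · obtain ⟨h', h1⟩ := hK m h hm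
      exact ⟨h', fun _ => h1⟩
    · exact ⟨h, fun h' => absurd h' hm⟩
  choose nx hnx using hK'
  let t : ℕ → H := fun i => i.rec h fun i y => nx (n + i) y
  have hKt : ∀ i, K (n + i) (t i) := by
    intro i
    induction i with
    | zero => exact hn
    | succ i ih => exact (hnx _ _ ih).2
  obtain ⟨g, h1, h2, h3⟩ := hr.exists_path t rfl fun i => (hnx _ _ (hKt i)).1
  refine ⟨g, h1, h2, h3 0, fun m hm => ?_⟩
  obtain ⟨i, rfl⟩ := Nat.exists_eq_add_of_le hm
  rw [h3]
  exact hKt i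

variable {AP : Type u} {Q : Type v} [Finite Q]

/-- If Duplicator wins, the dominant word has at most the rank of the alternative word. -/
theorem rank_le_rank_of_wins {A : ACA AP Q} (hA : A.NoConstants) {σ σ' : Word AP}
    (hw : (ddGame A σ σ').Wins₀) : rank A σ' A.init 0 ≤ rank A σ A.init 0 := by
  obtain ⟨H, alt, dom, R, h₀, halt, hdom, hstep, hwin⟩ := exists_system_of_wins hA hw
  suffices hmain : ∀ α, ∀ n h, Reach R h₀ n h → rank A σ (alt h) n = α →
      rank A σ' (dom h) n ≤ α by
    have := hmain _ 0 h₀ .zero rfl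
    rwa [halt, hdom] at this
  intro α
  induction α using WellFoundedLT.induction with
  | _ α ih =>
  intro n h hr hα
  by_contra! hlt
  have hαtop : α ≠ ⊤ := hlt.ne_top
  -- At a successor `α` the optimal clause lowers the alternative rank, while Spoiler lets the
  -- dominant rank fall by at most one: a violation at a smaller rank.
  have hlim : IsSuccPrelimit α := by
    by_contra hnl
    obtain ⟨-, c, hc, hopt⟩ := isProgressMeasure_rank A σ (alt h) n (hα ▸ hαtop)
    rw [hα] at hopt
    obtain ⟨c', hc', hans⟩ := hstep n h c hc
    obtain ⟨q', hq', hle⟩ := exists_mem_rank_le_succ hA hc'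
    obtain ⟨h', hR, hp', rfl⟩ := hans q' hq'
    have h1 := (hopt _ hp').2 hnl
    exact (ih _ h1 _ _ (hr.succ hR) rfl).not_gt (h1.trans_le (le_of_lt_succ (hlt.trans_le hle)))
  have hrej : ∀ m h, rank A σ (alt h) m = α → alt h ∉ A.rej := by
    intro m h he hF
    exact (isProgressMeasure_rank A σ (alt h) m (he ▸ hαtop)).1 hF (he ▸ hlim)
  -- Against the optimal clause the alternative rank must remain exactly `α`: falling below it while
  -- the dominant rank stays at least `α` contradicts the induction hypothesis.
  have hmove : ∀ m h (P : Q → Prop), Reach R h₀ m h → rank A σ (alt h) m = α →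
      (∀ c' ∈ A.trans (dom h) (σ' m), ∃ q' ∈ c', α ≤ rank A σ' q' (m + 1) ∧ P q') →
      ∃ h', R m h h' ∧ Reach R h₀ (m + 1) h' ∧ rank A σ (alt h') (m + 1) = α ∧
        α ≤ rank A σ' (dom h') (m + 1) ∧ P (dom h') := by
    intro m h P hr he hc'
    obtain ⟨-, c, hc, hopt⟩ := isProgressMeasure_rank A σ (alt h) m (he ▸ hαtop)
    rw [he] at hopt
    obtain ⟨c', hcc, hans⟩ := hstep m h c hc
    obtain ⟨q', hq', hle, hP⟩ := hc' c' hcc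
    obtain ⟨h', hR, hp', rfl⟩ := hans q' hq'
    refine ⟨h', hR, hr.succ hR, ((hopt _ hp').1).eq_of_not_lt fun hlt' => ?_, hle, hP⟩
    exact (ih _ hlt' _ _ (hr.succ hR) rfl).not_gt (hlt'.trans_le hle)
  -- Spoiler can hold the dominant rank at or above the limit `α` forever. The alternative state is
  -- then never rejecting again, so a rejecting dominant state would lose for Duplicator.
  have hstay : ∀ m h, Reach R h₀ m h → rank A σ (alt h) m = α → α ≤ rank A σ' (dom h) m →
      dom h ∉ A.rej := by
    intro m h hr he hle hF
    have hK : ∀ m h, Reach R h₀ m h ∧ rank A σ (alt h) m = α ∧ α ≤ rank A σ' (dom h) m →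
        ∃ h', R m h h' ∧ Reach R h₀ (m + 1) h' ∧ rank A σ (alt h') (m + 1) = α ∧
          α ≤ rank A σ' (dom h') (m + 1) := by
      rintro m h ⟨hr, he, hle⟩
      obtain ⟨h', h1, h2, h3, h4, -⟩ := hmove m h (fun _ => True) hr he fun c' hc' => by
        obtain ⟨q', hq', h⟩ := exists_mem_rank_le_succ hA hc'
        refine ⟨q', hq', ?_, trivial⟩
        by_contra! hlt'
        exact ((hle.trans h).trans_lt (hlim.succ_lt hlt')).false
      exact ⟨h', h1, h2, h3, h4⟩
    obtain ⟨g, hg0, hg, hgm, hgK⟩ := hr.exists_path_of_forall _ hK ⟨hr, he, hle⟩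
    obtain ⟨k, hk, hF'⟩ := hwin g hg0 hg m (by rwa [hgm])
    exact hrej k _ (hgK k hk).2.1 hF'
  obtain ⟨cd, hcd⟩ := exists_countdown A σ' hlim
  -- Strictly above `α` the countdown decreases at every nonrejecting dominant state, and by `hstay`
  -- no other state occurs: an infinite descent.
  have hcount : ∀ k m h, Reach R h₀ m h → rank A σ (alt h) m = α → α < rank A σ' (dom h) m →
      cd (dom h) m = k → False := by
    intro k
    induction k using Nat.strong_induction_on with
    | _ k ihk =>
    intro m h hr he hlt hk
    obtain ⟨h', h1, h2, h3, -, h4, h5⟩ := hmove m h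
      (fun q' => α < rank A σ' q' (m + 1) ∧ cd q' (m + 1) < cd (dom h) m) hr he fun c' hc' => by
        obtain ⟨q', hq', g1, g2⟩ := hcd _ _ hlt (hstay m h hr he hlt.le) c' hc'
        exact ⟨q', hq', g1.le, g1, g2⟩
    exact ihk _ (hk ▸ h5) _ _ h2 h3 h4 rfl
  exact hcount _ n h hr hα hlt rfl

end Duel

/-! ### The automaton for delay-dominance -/

section Automaton

open Order

variable {AP : Type u} {Q : Type v} [Finite Q]

theorem succMark_eq {S : Type*} (F : Set S) (p q : S) (m : Bool) :
    ∃ m', succMark F p q m = (p, q, m') ∧ (m' = false ↔ p ∉ F ∧ (q ∈ F ∨ m = false)) := by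
  unfold succMark
  cases m <;> by_cases hp : p ∈ F <;> by_cases hq : q ∈ F <;> simp [hp, hq]

/-- By distributivity, a clause of the nested formula collects the outcomes of one system of
Duplicator's answers to all choices of Spoiler in a round. -/
theorem exists_mem_prodTrans {A : ACA AP Q} {p q : Q} {m : Bool} {a a' : Set AP}
    (G : Q × Q × Bool → Prop)
    (h : ∀ c ∈ A.trans p a', ∃ c' ∈ A.trans q a, ∀ q' ∈ c', ∃ p' ∈ c,
      G (succMark A.rej p' q' m)) :
    ∃ C ∈ prodTrans A p q m a a', ∀ y ∈ C, G y := by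
  classical
  choose! cl hcl alt halt using h
  refine ⟨_, ⟨fun c => ⋃ q' ∈ cl c, {succMark A.rej (alt c q') q' m}, fun c hc => ?_, rfl⟩, ?_⟩
  · refine Set.mem_biUnion (hcl c hc) ⟨fun q' => {succMark A.rej (alt c q') q' m}, ?_, rfl⟩
    exact fun q' hq' => Set.mem_biUnion (halt c hc q' hq').1 rfl
  · intro y hy
    simp only [Set.mem_iUnion, Set.mem_singleton_iff] at hy
    obtain ⟨c, hc, q', hq', rfl⟩ := hy
    exact (halt c hc q' hq').2

theorem exists_mem_of_mem_prodTrans {A : ACA AP Q} {p q : Q} {m : Bool} {a a' : Set AP}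
    {C : Set (Q × Q × Bool)} (hC : C ∈ prodTrans A p q m a a') {c : Set Q}
    (hc : c ∈ A.trans p a') :
    ∃ c' ∈ A.trans q a, ∀ q' ∈ c', ∃ p' ∈ c, succMark A.rej p' q' m ∈ C := by
  obtain ⟨f, hf, rfl⟩ := hC
  have h := hf c hc
  simp only [DNF.bigOr, Set.mem_iUnion] at h
  obtain ⟨c', hc', g, hg, hfc⟩ := h
  refine ⟨c', hc', fun q' hq' => ?_⟩
  have h := hg q' hq'
  simp only [Set.mem_iUnion] at h
  obtain ⟨p', hp', h⟩ := h
  refine ⟨p', hp', Set.mem_biUnion hc ?_⟩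
  rw [hfc]
  refine Set.mem_biUnion hq' ?_
  rw [show g q' = {succMark A.rej p' q' m} from h]
  rfl

variable {In : Type u} {Out : Type w} {Qc : Type x} [Finite Qc]

theorem unprimedPart_jointWord (s t : ProcStrategy In Out) (γ : Word In) (n : ℕ) :
    unprimedPart (jointWord s t γ n) = comp s γ n := by
  ext y
  simp only [unprimedPart, jointWord, pr, Set.mem_ofPred_eq, Set.mem_union, Set.mem_image]
  constructor
  · rintro (⟨z, hz, h⟩ | ⟨z, ⟨-, ⟨o, rfl⟩⟩, h⟩)
    · exact Sum.inl.inj h ▸ hz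
    · exact absurd h (by simp [primeVar])
  · exact fun h => Or.inl ⟨y, h, rfl⟩

theorem primedPart_jointWord (s t : ProcStrategy In Out) (γ : Word In) (n : ℕ) :
    primedPart (jointWord s t γ n) = comp t γ n := by
  ext y
  rcases y with i | o <;>
    simp [primedPart, jointWord, pr, primeVar, comp]

theorem map_prodTrans_subset_trans (A : ACA (In ⊕ Out) Q) (Ac : ACA (In ⊕ Out) Qc) (p q : Q)
    (m : Bool) (a : Set (PrVar In Out)) :
    (prodTrans A p q m (unprimedPart a) (primedPart a)).map Sum.inl ⊆
      (ddACA A Ac).trans (.inl (p, q, m)) a := by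
  intro C hC
  simp only [ddACA]
  split_ifs
  · exact Or.inr hC
  · exact hC

theorem mem_trans_inl {A : ACA (In ⊕ Out) Q} {Ac : ACA (In ⊕ Out) Qc} {p q : Q}
    {m : Bool} {a : Set (PrVar In Out)} {C : Set ((Q × Q × Bool) ⊕ Qc)}
    (hC : C ∈ (ddACA A Ac).trans (.inl (p, q, m)) a) :
    C ∈ (prodTrans A p q m (unprimedPart a) (primedPart a)).map Sum.inl ∨
      (p = A.init ∧ q = A.init ∧ m = true ∧
        C ∈ (Ac.trans Ac.init (primedPart a)).map Sum.inr) := by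
  simp only [ddACA] at hC
  split_ifs at hC with h
  · simp only [Prod.mk.injEq] at h
    exact hC.elim (fun h' => Or.inr ⟨h.1, h.2.1, h.2.2, h'⟩) Or.inl
  · exact Or.inl hC

theorem inl_mem_rej {A : ACA (In ⊕ Out) Q} {Ac : ACA (In ⊕ Out) Qc} {y : Q × Q × Bool} :
    (.inl y : (Q × Q × Bool) ⊕ Qc) ∈ (ddACA A Ac).rej ↔ y.2.2 = false := by
  obtain ⟨p, q, m⟩ := y
  simp [ddACA]

theorem inr_mem_rej {A : ACA (In ⊕ Out) Q} {Ac : ACA (In ⊕ Out) Qc} {r : Qc} :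
    (.inr r : (Q × Q × Bool) ⊕ Qc) ∈ (ddACA A Ac).rej ↔ r ∈ Ac.rej := by
  simp [ddACA]

/-- A run of the automaton for the negation is a run of the product from its initial state. -/
theorem ddACA_accepts_of_accepts (A : ACA (In ⊕ Out) Q) {Ac : ACA (In ⊕ Out) Qc}
    {W : Word (PrVar In Out)} (h : Ac.Accepts fun n => primedPart (W n)) :
    (ddACA A Ac).Accepts W := by
  obtain ⟨T, ℓ, hT, hfin⟩ := h
  -- The same tree serves; only the root is relabelled, which affects finiteness at level `0` alone.
  let ℓ' : List ℕ → (Q × Q × Bool) ⊕ Qc := fun y =>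
    if y = [] then .inl (A.init, A.init, true) else .inr (ℓ y)
  have hℓ : ∀ y d, ℓ' (y ++ [d]) = .inr (ℓ (y ++ [d])) := fun y d => if_neg (by simp)
  have hch : ∀ y, {q | ∃ d : ℕ, y ++ [d] ∈ T ∧ ℓ' (y ++ [d]) = q} =
      Sum.inr '' {q | ∃ d : ℕ, y ++ [d] ∈ T ∧ ℓ (y ++ [d]) = q} := by
    intro y
    ext q
    constructor
    · rintro ⟨d, hd, rfl⟩
      exact ⟨_, ⟨d, hd, rfl⟩, (hℓ y d).symm⟩
    · rintro ⟨_, ⟨d, hd, rfl⟩, rfl⟩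
      exact ⟨d, hd, hℓ y d⟩
  refine ⟨T, ℓ', ⟨hT.root_mem, hT.prefix_closed, if_pos rfl, fun y hy => ?_⟩, fun b hb => ?_⟩
  · rw [hch]
    have h := Set.mem_image_of_mem (fun c => (Sum.inr '' c : Set ((Q × Q × Bool) ⊕ Qc)))
      (hT.children y hy)
    by_cases hy0 : y = []
    · subst hy0
      rw [hT.root_label] at h
      simp only [ℓ', if_true, ddACA]
      exact Or.inl h
    · simp only [ℓ', if_neg hy0]
      exact h
  · refine ((hfin b hb).union (Set.finite_singleton 0)).subset fun n hn => ?_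
    rcases n with _ | n
    · exact Or.inr rfl
    · left
      obtain ⟨d, hd⟩ := (hb.2 n).2
      have hn' : ℓ' (b (n + 1)) ∈ (ddACA A Ac).rej := hn
      rw [hd, hℓ, inr_mem_rej, ← hd] at hn'
      exact hn'

/-- If the dominant word has a finite rank that is at most the rank of the alternative word, the
product accepts. -/
theorem ddACA_accepts_of_rank_le {A : ACA (In ⊕ Out) Q} (hA : A.NoConstants)
    (Ac : ACA (In ⊕ Out) Qc) {W : Word (PrVar In Out)} {σ σ' : Word (In ⊕ Out)}
    (hσ : ∀ n, primedPart (W n) = σ n) (hσ' : ∀ n, unprimedPart (W n) = σ' n)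
    (hne : rank A σ' A.init 0 ≠ ⊤) (hle : rank A σ' A.init 0 ≤ rank A σ A.init 0) :
    (ddACA A Ac).Accepts W := by
  choose! cd hcd using fun α (hα : IsSuccPrelimit α) => exists_countdown A σ hα
  let μ : ℕ → Q × Q × Bool → WithTop Ordinal.{v} ×ₗ ℕ := fun n h =>
    toLex (rank A σ' h.2.1 n, if h.2.2 = true then 0 else cd (rank A σ' h.2.1 n) h.1 n + 1)
  let I : ℕ → Q × Q × Bool → Prop := fun n h =>
    rank A σ' h.2.1 n ≠ ⊤ ∧ rank A σ' h.2.1 n ≤ rank A σ h.1 n ∧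
      (h.2.2 = false → h.1 ∉ A.rej ∧
        (IsSuccPrelimit (rank A σ' h.2.1 n) → rank A σ' h.2.1 n < rank A σ h.1 n))
  let R : ℕ → Q × Q × Bool → Q × Q × Bool → Prop := fun n h h' =>
    μ (n + 1) h' ≤ μ n h ∧ (h.2.2 = false → μ (n + 1) h' < μ n h)
  refine accepts_of_system (ddACA A Ac) W (fun h => (.inl h : (Q × Q × Bool) ⊕ Qc)) I R
    (A.init, A.init, true) ⟨hne, hle, fun h => by simp at h⟩ rfl ?_ ?_
  · rintro n ⟨p, q, m⟩ ⟨hq, hqp, hm⟩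
    dsimp only at hq hqp hm
    obtain ⟨C, hC, hC'⟩ := exists_mem_prodTrans (A := A) (p := p) (q := q) (m := m)
      (a := unprimedPart (W n)) (a' := primedPart (W n))
      (fun h' => I (n + 1) h' ∧ R n (p, q, m) h') (by
        rw [hσ, hσ']
        intro c hc
        obtain ⟨-, c', hc', hopt⟩ := isProgressMeasure_rank A σ' q n hq
        refine ⟨c', hc', fun q' hq' => ?_⟩
        obtain ⟨hqle, hqlt⟩ := hopt q' hq'
        have hq'top : rank A σ' q' (n + 1) ≠ ⊤ := (hqle.trans_lt hq.lt_top).ne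
        have hlt_of : ∀ p' m', rank A σ' q' (n + 1) < rank A σ' q n →
            μ (n + 1) (p', q', m') < μ n (p, q, m) :=
          fun p' m' h => Prod.Lex.toLex_lt_toLex.2 (Or.inl h)
        have hlt_of' : ¬ IsSuccPrelimit (rank A σ' q' (n + 1)) →
            rank A σ' q' (n + 1) < rank A σ' q n := by
          intro h
          refine hqle.lt_of_ne fun he => ?_
          exact (hqlt (he ▸ h)).ne he
        -- With a visit pending at a limit dominant rank, the rank itself need not drop, so
        -- Duplicator follows the countdown on the alternative side. In all other cases keeping the
        -- alternative rank high suffices.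
        by_cases hcase : m = false ∧ IsSuccPrelimit (rank A σ' q' (n + 1))
        · obtain ⟨rfl, hlim⟩ := hcase
          have hlt : rank A σ' q' (n + 1) < rank A σ p n := by
            rcases hqle.lt_or_eq with h | h
            · exact h.trans_le hqp
            · rw [h] at hlim ⊢
              exact (hm rfl).2 hlim
          obtain ⟨p', hp', h1, h2⟩ := hcd _ hlim p n hlt (hm rfl).1 c hc
          obtain ⟨m', hm', hmark⟩ := succMark_eq A.rej p' q' false
          refine ⟨p', hp', ?_⟩
          rw [hm']
          have hμ : μ (n + 1) (p', q', m') < μ n (p, q, false) := by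
            rcases hqle.lt_or_eq with h | h
            · exact hlt_of _ _ h
            · refine Prod.Lex.toLex_lt_toLex.2 (Or.inr ⟨h, ?_⟩)
              rw [h] at h2
              simp only [h, Bool.false_eq_true, if_false]
              split_ifs
              · exact Nat.succ_pos _
              · exact Nat.succ_lt_succ h2
          exact ⟨⟨hq'top, h1.le, fun h => ⟨(hmark.1 h).1, fun _ => h1⟩⟩, hμ.le, fun _ => hμ⟩
        · obtain ⟨p', hp', hpp⟩ := exists_mem_rank_le_succ hA hc
          obtain ⟨m', hm', hmark⟩ := succMark_eq A.rej p' q' m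
          refine ⟨p', hp', ?_⟩
          rw [hm']
          -- A mark newly set to `⊥` comes from a rejecting `q'`, whose rank is a successor. The
          -- dominant rank then has to drop in this step.
          have hnl : m = false ∨ m' = false → ¬ IsSuccPrelimit (rank A σ' q' (n + 1)) := by
            intro h
            have h' : m = false ∨ q' ∈ A.rej := h.elim Or.inl fun h => (hmark.1 h).2.symm
            exact h'.elim (fun h hl => hcase ⟨h, hl⟩)
              (isProgressMeasure_rank A σ' q' (n + 1) hq'top).1
          refine ⟨⟨hq'top, le_of_le_of_le_succ hqp hqle hqlt hpp, fun h =>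
            ⟨(hmark.1 h).1, fun hl => absurd hl (hnl (Or.inr h))⟩⟩, ?_,
            fun h => hlt_of _ _ (hlt_of' (hnl (Or.inl h)))⟩
          by_cases hmm : m = false ∨ m' = false
          · exact (hlt_of _ _ (hlt_of' (hnl hmm))).le
          · simp only [not_or, Bool.not_eq_false] at hmm
            obtain ⟨rfl, rfl⟩ := hmm
            exact Prod.Lex.toLex_le_toLex.2 (hqle.lt_or_eq.imp id fun h => ⟨h, le_rfl⟩))
    refine ⟨Sum.inl '' C, map_prodTrans_subset_trans A Ac p q m (W n) ⟨C, hC, rfl⟩, ?_⟩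
    rintro _ ⟨h', hh', rfl⟩
    exact ⟨h', (hC' h' hh').1, (hC' h' hh').2, rfl⟩
  · intro f _ hf
    refine (finite_setOf_lt_of_antitone (f := fun n => μ n (f n)) fun n => (hf n).2.1).subset
      fun n hn => (hf n).2.2 ?_
    exact (inl_mem_rej (A := A) (Ac := Ac)).1 hn

end Automaton

/-! ### ### From accepting runs to winning strategies of Duplicator -/

section Strategy

variable {Q : Type v} [Finite Q] {In : Type u} {Out : Type w} {Qc : Type x} [Finite Qc]

/-- If an accepting run tree of the product moves from `x` to the automaton for the negation, this
automaton accepts the suffix of the alternative word that starts at the level of `x`. -/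
theorem accepts_drop_of_children_inr {A : ACA (In ⊕ Out) Q} {Ac : ACA (In ⊕ Out) Qc}
    {W : Word (PrVar In Out)} {T : Set (List ℕ)} {ℓ : List ℕ → (Q × Q × Bool) ⊕ Qc}
    (hT : (ddACA A Ac).IsRunTree W T ℓ)
    (hfin : ∀ b, ACA.IsInfBranch T b → {n | ℓ (b n) ∈ (ddACA A Ac).rej}.Finite)
    {y₀ : List ℕ} (hy₀ : y₀ ∈ T) {y : Q × Q × Bool} (hℓ : ℓ y₀ = .inl y)
    (hch : {q | ∃ d : ℕ, y₀ ++ [d] ∈ T ∧ ℓ (y₀ ++ [d]) = q} ∈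
      (Ac.trans Ac.init (primedPart (W y₀.length))).map Sum.inr) :
    Ac.Accepts (Word.drop (fun n => primedPart (W n)) y₀.length) := by
  -- The node `y₀` still carries a pair as its label; it is read as the initial state of `Ac`.
  refine accepts_of_system Ac _ (H := List ℕ) (fun y => Sum.elim (fun _ => Ac.init) id (ℓ y))
    (fun n y => y ∈ T ∧ y.length = y₀.length + n ∧ (y = y₀ ∨ ∃ r, ℓ y = .inr r))
    (fun _ y y' => ∃ d : ℕ, y' = y ++ [d]) y₀ ⟨hy₀, rfl, Or.inl rfl⟩ (by rw [hℓ]; rfl) ?_ ?_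
  · rintro n y ⟨hy, hlen, hlab⟩
    have hch' : {q | ∃ d : ℕ, y ++ [d] ∈ T ∧ ℓ (y ++ [d]) = q} ∈
        (Ac.trans (Sum.elim (fun _ => Ac.init) id (ℓ y))
          (primedPart (W (y₀.length + n)))).map Sum.inr := by
      rcases hlab with rfl | ⟨r, hr⟩
      · rw [hℓ, ← hlen]
        exact hch
      · have h := hT.children y hy
        rw [hr] at h ⊢
        rw [← hlen]
        exact h
    obtain ⟨C, hC, hCeq⟩ := hch'
    refine ⟨C, hC, fun q hq => ?_⟩
    have hmem : (Sum.inr q : (Q × Q × Bool) ⊕ Qc) ∈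
        {q | ∃ d : ℕ, y ++ [d] ∈ T ∧ ℓ (y ++ [d]) = q} := hCeq ▸ Set.mem_image_of_mem _ hq
    obtain ⟨d, hd, hq'⟩ := hmem
    refine ⟨y ++ [d], ⟨hd, ?_, Or.inr ⟨q, hq'⟩⟩, ⟨d, rfl⟩, by rw [hq']; rfl⟩
    rw [List.length_append, hlen, List.length_singleton, Nat.add_assoc]
  · intro f hf0 hf
    -- The prefixes of `y₀` complete the path to a branch of `T`, to which `hfin` applies.
    let b : ℕ → List ℕ := fun n => if n < y₀.length then y₀.take n else f (n - y₀.length)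
    have hb : ∀ n, b (y₀.length + n) = f n := by
      intro n
      simp [b]
    have hbt : ∀ n ≤ y₀.length, b n = y₀.take n := by
      intro n hn
      rcases hn.lt_or_eq with h | rfl
      · exact if_pos h
      · rw [List.take_length]
        exact (hb 0).trans hf0
    have hbranch : ACA.IsInfBranch T b := by
      refine ⟨by rw [hbt 0 (Nat.zero_le _), List.take_zero], fun n => ?_⟩
      rcases lt_or_ge n y₀.length with h | h
      · rw [hbt n h.le, hbt (n + 1) h]
        exact ⟨hT.prefix_closed _ _ (List.take_prefix _ _) hy₀, y₀[n],
          (List.take_append_getElem h).symm⟩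
      · obtain ⟨k, rfl⟩ := Nat.exists_eq_add_of_le h
        rw [Nat.add_assoc, hb, hb]
        exact ⟨(hf k).1.1, (hf k).2⟩
    have hpre := (hfin b hbranch).preimage (f := fun n => y₀.length + n)
      (fun _ _ _ _ h => Nat.add_left_cancel h)
    refine (hpre.union (Set.finite_singleton 0)).subset fun n hn => ?_
    rcases n with _ | n
    · exact Or.inr rfl
    · left
      change ℓ (b (y₀.length + (n + 1))) ∈ (ddACA A Ac).rej
      have hn' : Sum.elim (fun _ => Ac.init) id (ℓ (f (n + 1))) ∈ Ac.rej := hn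
      obtain ⟨-, hlen, hlab⟩ := (hf (n + 1)).1
      rw [hb]
      rcases hlab with h | ⟨r, hr⟩
      · rw [h] at hlen
        omega
      · rw [hr] at hn' ⊢
        exact inr_mem_rej.2 hn'

/-- An accepting run tree of the product yields a winning strategy of Duplicator. -/
theorem wins_of_ddACA_accepts {A : ACA (In ⊕ Out) Q} (hA : A.NoConstants)
    {Ac : ACA (In ⊕ Out) Qc} (hneg : ∀ w, Ac.Accepts w → ¬ A.Accepts w)
    {W : Word (PrVar In Out)} {σ σ' : Word (In ⊕ Out)}
    (hσ : ∀ n, primedPart (W n) = σ n) (hσ' : ∀ n, unprimedPart (W n) = σ' n)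
    (hacc : (ddACA A Ac).Accepts W) : (ddGame A σ σ').Wins₀ := by
  obtain ⟨T, ℓ, hT, hfin⟩ := hacc
  choose cd hcd using fun j => exists_countdown_top hA (σ.drop j)
  -- Duplicator either follows a node of the run tree (`inl`) or, after the run has entered `Ac` at
  -- level `j`, keeps the rank of the suffix from `j` at `⊤` (`inr j`).
  let I : ℕ → Q × Q × Bool × (List ℕ ⊕ ℕ) → Prop := fun n h =>
    match h.2.2.2 with
    | .inl y => y ∈ T ∧ y.length = n ∧ ℓ y = .inl (h.1, h.2.1, h.2.2.1)
    | .inr j => j ≤ n ∧ rank A (σ.drop j) h.1 (n - j) = ⊤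
  let R : ℕ → Q × Q × Bool × (List ℕ ⊕ ℕ) → Q × Q × Bool × (List ℕ ⊕ ℕ) → Prop := fun n h h' =>
    match h.2.2.2, h'.2.2.2 with
    | .inl y, .inl y' => (∃ d : ℕ, y' = y ++ [d]) ∧
        (h'.2.2.1 = false ↔ h'.1 ∉ A.rej ∧ (h'.2.1 ∈ A.rej ∨ h.2.2.1 = false))
    | .inl _, .inr _ => True
    | .inr _, .inl _ => False
    | .inr j, .inr j' => j' = j ∧ (h.1 ∉ A.rej → cd j h'.1 (n + 1 - j) < cd j h.1 (n - j))
  have hescape : ∀ n j p c, j ≤ n → rank A (σ.drop j) p (n - j) = ⊤ → c ∈ A.trans p (σ n) →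
      ∃ p' ∈ c, rank A (σ.drop j) p' (n + 1 - j) = ⊤ ∧
        (p ∉ A.rej → cd j p' (n + 1 - j) < cd j p (n - j)) := by
    intro n j p c hj hr hc
    have hword : σ.drop j (n - j) = σ n := congrArg σ (Nat.add_sub_cancel' hj)
    rw [Nat.succ_sub hj]
    exact hcd j p (n - j) hr c (hword ▸ hc)
  refine wins_of_system A σ σ' (fun h => h.1) (fun h => h.2.1) I R
    (A.init, A.init, true, .inl []) ⟨hT.root_mem, rfl, hT.root_label⟩ rfl rfl ?_ ?_
  · rintro n ⟨p, q, m, y | j⟩ hI c hc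
    · obtain ⟨hy, hlen, hℓ⟩ := hI
      dsimp only at hlen hℓ hc ⊢
      have hch := hT.children y hy
      rw [hℓ] at hch
      rcases mem_trans_inl hch with ⟨C, hC, hCeq⟩ | ⟨rfl, rfl, rfl, hCinr⟩
      · rw [hlen, hσ, hσ'] at hC
        obtain ⟨c', hc', hans⟩ := exists_mem_of_mem_prodTrans hC hc
        refine ⟨c', hc', fun q' hq' => ?_⟩
        obtain ⟨p', hp', hmem⟩ := hans q' hq'
        obtain ⟨m', hm', hmark⟩ := succMark_eq A.rej p' q' m
        rw [hm'] at hmem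
        have hmem' : (Sum.inl (p', q', m') : (Q × Q × Bool) ⊕ Qc) ∈
            {q | ∃ d : ℕ, y ++ [d] ∈ T ∧ ℓ (y ++ [d]) = q} := hCeq ▸ Set.mem_image_of_mem _ hmem
        obtain ⟨d, hd, hd'⟩ := hmem'
        exact ⟨(p', q', m', .inl (y ++ [d])), ⟨hd, by simp [hlen], hd'⟩, ⟨⟨d, rfl⟩, hmark⟩,
          hp', rfl⟩
      -- The initial pair may recur, so the run can enter `Ac` at any level `n`. The suffix from `n`
      -- is then rejected by `A`, and the dominant side no longer matters.
      · have hrej : ¬ A.Accepts (σ.drop n) := by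
          have h := accepts_drop_of_children_inr hT hfin hy hℓ hCinr
          simp only [hσ, hlen] at h
          exact hneg _ h
        have htop : rank A (σ.drop n) A.init 0 = ⊤ := by
          by_contra h
          exact hrej (accepts_of_rank_ne_top A _ h)
        obtain ⟨c', hc'⟩ := (hA A.init (σ' n)).1
        obtain ⟨p', hp', h1, -⟩ := hescape n n A.init c le_rfl (by rwa [Nat.sub_self]) hc
        exact ⟨c', hc', fun q' _ =>
          ⟨(p', q', true, .inr n), ⟨Nat.le_succ n, h1⟩, trivial, hp', rfl⟩⟩
    · obtain ⟨hj, hr⟩ := hI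
      obtain ⟨c', hc'⟩ := (hA q (σ' n)).1
      obtain ⟨p', hp', h1, h2⟩ := hescape n j p c hj hr hc
      exact ⟨c', hc', fun q' _ =>
        ⟨(p', q', true, .inr j), ⟨hj.trans (Nat.le_succ n), h1⟩, ⟨rfl, h2⟩, hp', rfl⟩⟩
  · intro f hf0 hf i hi
    by_cases hesc : ∃ N j, (f N).2.2.2 = .inr j
    · obtain ⟨N, j, hN⟩ := hesc
      have hinr : ∀ n ≥ N, (f n).2.2.2 = .inr j := by
        intro n hn
        induction n, hn using Nat.le_induction with
        | base => exact hN
        | succ n _ ih =>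
          have hR := (hf n).2
          simp only [R, ih] at hR
          split at hR
          · simp_all
          · simp_all
          · exact hR.elim
          · rename_i h1 h2
            rw [h2, hR.1]
            exact h1.symm
      obtain ⟨k, hk, hF⟩ := exists_ge_mem_of_countdown (F := A.rej) (p := fun n => (f n).1)
        (g := fun n => cd j (f n).1 (n - j)) (N := N) (fun n hn => by
          have hR := (hf n).2
          simp only [R, hinr n hn, hinr (n + 1) (by omega)] at hR
          exact hR.2) (le_max_left N i)
      exact ⟨k, (le_max_right N i).trans hk, hF⟩
    · have hinl : ∀ n, ∃ y, (f n).2.2.2 = .inl y := by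
        intro n
        rcases h : (f n).2.2.2 with y | j
        · exact ⟨y, rfl⟩
        · exact absurd ⟨n, j, h⟩ hesc
      choose b hb using hinl
      have hIb : ∀ n, b n ∈ T ∧ (b n).length = n ∧
          ℓ (b n) = .inl ((f n).1, (f n).2.1, (f n).2.2.1) := by
        intro n
        have h := (hf n).1
        simp only [I, hb] at h
        exact h
      have hRb : ∀ n, (∃ d : ℕ, b (n + 1) = b n ++ [d]) ∧ ((f (n + 1)).2.2.1 = false ↔
          (f (n + 1)).1 ∉ A.rej ∧ ((f (n + 1)).2.1 ∈ A.rej ∨ (f n).2.2.1 = false)) := by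
        intro n
        have h := (hf n).2
        simp only [R, hb] at h
        exact h
      have hfinb := hfin b ⟨List.length_eq_zero_iff.1 (hIb 0).2.1,
        fun n => ⟨(hIb n).1, (hRb n).1⟩⟩
      -- An unanswered visit at `i` keeps the mark at `⊥` on the whole remaining branch, which
      -- `hfinb` excludes.
      by_contra! hno
      have hmark : ∀ n ≥ i, (f n).2.2.1 = false := by
        intro n hn
        induction n, hn using Nat.le_induction with
        | base =>
          rcases i with _ | i
          · have h := hno 0 le_rfl
            rw [hf0] at h hi
            exact absurd hi h
          · exact (hRb i).2.2 ⟨hno _ le_rfl, Or.inl hi⟩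
        | succ n hn ih => exact (hRb n).2.2 ⟨hno _ (by omega), Or.inr ih⟩
      refine Set.infinite_of_not_bddAbove (not_bddAbove_Ici (a := i)) (hfinb.subset fun n hn => ?_)
      change ℓ (b n) ∈ (ddACA A Ac).rej
      rw [(hIb n).2.2, inl_mem_rej]
      exact hmark n hn

end Strategy

end DelayDom

theorem lemma10 {In Out Q Qc : Type*} [Finite Q] [Finite Qc]
    (φ : DelayDom.LTL (In ⊕ Out))
    (A : DelayDom.ACA (In ⊕ Out) Q) (Ac : DelayDom.ACA (In ⊕ Out) Qc)
    (hconst : A.NoConstants)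
    (hA : A.language = φ.language) (hAc : Ac.language = φ.neg.language)
    (s t : DelayDom.ProcStrategy In Out) (γ : DelayDom.Word In) :
    (DelayDom.ddACA A Ac).Accepts (DelayDom.jointWord s t γ) ↔
      DelayDom.DelayDominatesOn A s t γ := by
  have hcompl : ∀ w, Ac.Accepts w ↔ ¬ A.Accepts w := fun w =>
    (Set.ext_iff.1 hAc w).trans (not_congr (Set.ext_iff.1 hA w)).symm
  have hσ := DelayDom.primedPart_jointWord s t γ
  have hσ' := DelayDom.unprimedPart_jointWord s t γ
  refine ⟨DelayDom.wins_of_ddACA_accepts hconst (fun w => (hcompl w).1) hσ hσ', fun hw => ?_⟩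
  have hle := DelayDom.rank_le_rank_of_wins hconst hw
  -- A dominant rank `⊤` forces the alternative rank to `⊤`; the alternative word then satisfies the
  -- negation, and the run enters `Ac` at the root.
  by_cases htop : DelayDom.rank A (DelayDom.comp s γ) A.init 0 = ⊤
  · refine DelayDom.ddACA_accepts_of_accepts A ?_
    simp only [hσ]
    rw [htop, top_le_iff] at hle
    exact (hcompl _).2 (DelayDom.not_accepts_of_rank_eq_top hconst hle)
  · exact DelayDom.ddACA_accepts_of_rank_le hconst Ac hσ hσ' htop hle
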